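/- For a real number $\lambda>0$ let $\mathcal H^{(\lambda)}$ be the reproducing kernel Hilbert space of holomorphic functions on the open unit disc $\mathbb D$ with kernel $K^{(\lambda)}(z,w)=(1-z\bar w)^{-\lambda}$. A bounded operator $T$ on a complex Hilbert space is called weakly homogeneous if $\sigma(T)\subseteq\overline{\mathbb D}$ and $\varphi(T)$ is similar to $T$ (that is, $\varphi(T)=L^{-1}TL$ for some bounded invertible operator $L$) for every biholomorphic automorphism $\varphi(z)=e^{i\theta}\frac{z-a}{1-\bar a z}$ of $\mathbb D$ ($\theta\in\mathbb R$, $a\in\mathbb D$), where $\varphi(T)$ is defined by the holomorphic functional calculus. Theorem. Let $1\le\lambda\le\mu<\lambda+2$, and let $\psi$ be a continuous function on $\overline{\mathbb D}$ that is holomorphic on $\mathbb D$ and not identically zero. Then multiplication by the coordinate function $z$ defines bounded operators $M_z$ on $\mathcal H^{(\lambda)}$ and on $\mathcal H^{(\mu)}$, multiplication by $\psi$ defines a bounded operator $M_\psi:\mathcal H^{(\lambda)}\to\mathcal H^{(\mu)}$, and the operator $$T=\begin{pmatrix} M_z^* & M_\psi^*\\ 0 & M_z^*\end{pmatrix}\quad\text{on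 } \mathcal H^{(\lambda)}\oplus\mathcal H^{(\mu)}$$ is weakly homogeneous if and only if $\psi(z)\neq0$ for all $z\in\overline{\mathbb D}$. -/

import Mathlib

open Complex Metric
open scoped NNReal ComplexConjugate UnitDisc InnerProduct

noncomputable section

/-! ### The spaces `H^(lam)` of holomorphic functions on the unit disc -/

/-- The kernel `K^(lam)(z, w) = (1 - z * conj w) ^ (-lam)` on the unit disc (principal branch; the
base has positive real part), as a kernel acting on the one-dimensional space `ℂ`. -/
def discKernel (lam : ℝ≥0) : Matrix 𝔻 𝔻 (ℂ →L[ℂ] ℂ) :=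
  .of fun z w => (1 / (1 - (z : ℂ) * conj (w : ℂ)) ^ ((lam : ℝ) : ℂ)) • ContinuousLinearMap.id ℂ ℂ

/-- The (nonnegative) coefficients of the power series of `(1 - x) ^ (-lam)`. -/
theorem choose_nonneg (lam : ℝ≥0) (n : ℕ) : 0 ≤ Ring.choose ((lam : ℝ) + n - 1) n := by
  rw [← Ring.multichoose_eq]
  have h := Ring.factorial_nsmul_multichoose_eq_ascPochhammer (lam : ℝ) n
  rw [Polynomial.ascPochhammer_smeval_eq_eval, nsmul_eq_mul] at h
  have h1 : 0 ≤ (ascPochhammer ℝ n).eval (lam : ℝ) := by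
    induction n with
    | zero => simp
    | succ k ih =>
      rw [ascPochhammer_succ_eval]
      have := ih (by rw [← Polynomial.ascPochhammer_smeval_eq_eval, ← nsmul_eq_mul,
        Ring.factorial_nsmul_multichoose_eq_ascPochhammer])
      positivity
  have h2 : (0 : ℝ) < n.factorial := by positivity
  rw [← h] at h1
  exact nonneg_of_mul_nonneg_right h1 h2

theorem hasSum_discKernel (lam : ℝ≥0) {x : ℂ} (hx : ‖x‖ < 1) :
    HasSum (fun n : ℕ => ((Ring.choose ((lam : ℝ) + n - 1) n : ℝ) : ℂ) * x ^ n)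
      (1 / (1 - x) ^ ((lam : ℝ) : ℂ)) := by
  have h := (Complex.one_div_one_sub_cpow_hasFPowerSeriesOnBall_zero ((lam : ℝ) : ℂ)).hasSum
    (y := x) (by simpa [Metric.mem_eball, edist_zero_right, enorm_eq_nnnorm, ← NNReal.coe_lt_coe] using hx)
  simpa [FormalMultilinearSeries.ofScalars, mul_comm, Complex.ofReal_choose] using h

theorem norm_coe_mul_conj_lt_one (z w : 𝔻) : ‖(z : ℂ) * conj (w : ℂ)‖ < 1 := by
  rw [norm_mul, RCLike.norm_conj]
  exact mul_lt_one_of_nonneg_of_lt_one_left (norm_nonneg _) z.norm_lt_one w.norm_lt_one.le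

theorem discKernel_posSemidef (lam : ℝ≥0) : (discKernel lam).PosSemidef := by
  refine (RKHS.posSemidef_tfae.out 0 2 rfl rfl).2 ⟨?_, fun vv => ?_⟩
  · ext z w
    have h1 := (hasSum_discKernel lam (norm_coe_mul_conj_lt_one w z)).map (starRingEnd ℂ)
      Complex.continuous_conj
    have h2 := hasSum_discKernel lam (norm_coe_mul_conj_lt_one z w)
    have h3 := h1.unique (by
      convert h2 using 2 with n
      simp [mul_comm])
    have h4 : star (ContinuousLinearMap.id ℂ ℂ) = ContinuousLinearMap.id ℂ ℂ :=
      star_one (ℂ →L[ℂ] ℂ)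
    simpa [discKernel, Matrix.conjTranspose_apply, h4] using h3
  · have key : HasSum (fun n : ℕ => ((Ring.choose ((lam : ℝ) + n - 1) n : ℝ) : ℂ) *
        ((‖vv.sum fun x w => conj (x : ℂ) ^ n * w‖ ^ 2 : ℝ) : ℂ))
        (vv.sum fun x w => vv.sum fun x' w' => inner ℂ (discKernel lam x' x w) w') := by
      unfold Finsupp.sum
      have : ∀ n : ℕ, ((Ring.choose ((lam : ℝ) + n - 1) n : ℝ) : ℂ) *
          ((‖∑ x ∈ vv.support, conj (x : ℂ) ^ n * vv x‖ ^ 2 : ℝ) : ℂ) =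
          ∑ x ∈ vv.support, ∑ x' ∈ vv.support,
            conj (((Ring.choose ((lam : ℝ) + n - 1) n : ℝ) : ℂ) *
              ((x' : ℂ) * conj (x : ℂ)) ^ n) * (conj (vv x) * vv x') := by
        intro n
        rw [← Complex.normSq_eq_norm_sq, Complex.normSq_eq_conj_mul_self, map_sum,
          Finset.sum_mul_sum, Finset.mul_sum]
        refine Finset.sum_congr rfl fun x _ => ?_
        rw [Finset.mul_sum]
        refine Finset.sum_congr rfl fun x' _ => ?_
        simp [mul_pow]
        ring
      simp_rw [this]
      refine hasSum_sum fun x _ => hasSum_sum fun x' _ => ?_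
      have h1 := ((hasSum_discKernel lam (norm_coe_mul_conj_lt_one x' x)).map (starRingEnd ℂ)
        Complex.continuous_conj).mul_right (conj (vv x) * vv x')
      convert! h1 using 1
      simp [discKernel]
      ring
    have h := (Complex.hasSum_iff _ _).1 key |>.1
    refine h.nonneg fun n => ?_
    rw [← Complex.ofReal_mul, Complex.ofReal_re]
    exact mul_nonneg (choose_nonneg lam n) (by positivity)

instance factPosSemidefDiscKernel (lam : ℝ≥0) : Fact (discKernel lam).PosSemidef :=
  ⟨discKernel_posSemidef lam⟩

/-- The space `H^(lam)`: the Hilbert space of functions on the unit disc with reproducing kernel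
`K^(lam)`. Its elements are applied to points of the disc through the coercion to functions. -/
def DiscSpace (lam : ℝ≥0) : Type := RKHS.OfKernel (discKernel lam)

instance (lam : ℝ≥0) : NormedAddCommGroup (DiscSpace lam) :=
  inferInstanceAs (NormedAddCommGroup (RKHS.OfKernel (discKernel lam)))

instance (lam : ℝ≥0) : InnerProductSpace ℂ (DiscSpace lam) :=
  inferInstanceAs (InnerProductSpace ℂ (RKHS.OfKernel (discKernel lam)))

instance (lam : ℝ≥0) : CompleteSpace (DiscSpace lam) :=
  inferInstanceAs (CompleteSpace (RKHS.OfKernel (discKernel lam)))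

instance (lam : ℝ≥0) : RKHS ℂ (DiscSpace lam) 𝔻 ℂ :=
  inferInstanceAs (RKHS ℂ (RKHS.OfKernel (discKernel lam)) 𝔻 ℂ)

theorem kernel_discSpace (lam : ℝ≥0) : RKHS.kernel (DiscSpace lam) = discKernel lam :=
  RKHS.OfKernel.kernel_ofKernel (K := discKernel lam)

/-! ### Multiplication operators -/

/-- `psi` is a multiplier from `H^(lam)` to `H^(mu)`: there is a bounded linear operator
`H^(lam) → H^(mu)` which is pointwise multiplication by `psi`. -/
def IsMultiplier (lam mu : ℝ≥0) (psi : ℂ → ℂ) : Prop :=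
  ∃ L : DiscSpace lam →L[ℂ] DiscSpace mu, ∀ f : DiscSpace lam, ∀ z : 𝔻, L f z = psi z * f z

open Classical in
/-- The multiplication operator `M_psi : H^(lam) → H^(mu)`, for a multiplier `psi`
(the value is `0` if `psi` is not a multiplier). -/
def mulOp (lam mu : ℝ≥0) (psi : ℂ → ℂ) : DiscSpace lam →L[ℂ] DiscSpace mu :=
  if h : IsMultiplier lam mu psi then h.choose else 0

theorem mulOp_apply {lam mu : ℝ≥0} {psi : ℂ → ℂ} (h : IsMultiplier lam mu psi)
    (f : DiscSpace lam) (z : 𝔻) : mulOp lam mu psi f z = psi z * f z := by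
  rw [mulOp, dif_pos h]
  exact h.choose_spec f z

/-! ### Operator matrices -/

section Block

variable {E F : Type*} [NormedAddCommGroup E] [InnerProductSpace ℂ E]
  [NormedAddCommGroup F] [InnerProductSpace ℂ F]

/-- The operator `(x, y) ↦ (A x + B y, C x + D y)` on the Hilbert space direct sum `E ⊕ F`. -/
def blockOp (A : E →L[ℂ] E) (B : F →L[ℂ] E) (C : E →L[ℂ] F) (D : F →L[ℂ] F) :
    WithLp 2 (E × F) →L[ℂ] WithLp 2 (E × F) :=
  (WithLp.prodContinuousLinearEquiv 2 ℂ E F).symm.toContinuousLinearMap ∘L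
    ((A.coprod B).prod (C.coprod D)) ∘L
      (WithLp.prodContinuousLinearEquiv 2 ℂ E F).toContinuousLinearMap

theorem blockOp_apply (A : E →L[ℂ] E) (B : F →L[ℂ] E) (C : E →L[ℂ] F) (D : F →L[ℂ] F)
    (x : E) (y : F) : blockOp A B C D (WithLp.toLp 2 (x, y)) =
      WithLp.toLp 2 (A x + B y, C x + D y) := rfl

end Block

/-! ### Moebius transformations of an operator and weak homogeneity -/

/-- The automorphism `z ↦ exp (i theta) (z - a) / (1 - conj a * z)` of the unit disc. The Moebius
group consists of these functions, with `theta` real and `a` in the open unit disc. -/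
def moebius (theta : ℝ) (a : 𝔻) (z : ℂ) : ℂ :=
  exp (theta * I) * ((z - a) / (1 - conj (a : ℂ) * z))

section FunctionalCalculus

variable {A : Type*} [NormedRing A] [NormedAlgebra ℂ A]

/-- The holomorphic functional calculus `f(T) = (2 π i)⁻¹ ∮ f(z) (z - T)⁻¹ dz` along the circle of
radius `r` around `0`, for a function `f` which is holomorphic on a neighbourhood of the closed disc
of radius `r` and an element `T` whose spectrum lies in the open disc of radius `r`. -/
def holCalculus (f : ℂ → ℂ) (T : A) (r : ℝ) : A :=
  (2 * Real.pi * I : ℂ)⁻¹ • ∮ z in C(0, r), f z • resolvent T z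

/-- `φ(T)` for the Moebius transformation `φ = moebius theta a` and `T` with spectrum in the closed
unit disc. The function `φ` is holomorphic for `‖z‖ < 1 / ‖a‖`, and
`1 < 2 / (1 + ‖a‖) < 1 / ‖a‖`. -/
def moebiusCalculus (theta : ℝ) (a : 𝔻) (T : A) : A :=
  holCalculus (moebius theta a) T (2 / (1 + ‖(a : ℂ)‖))

theorem circleIntegral_resolvent [CompleteSpace A] {T : A} (hT : spectrum ℂ T ⊆ closedBall 0 1)
    {r : ℝ} (hr : 1 < r) :
    (∮ z in C(0, r), resolvent T z) = (2 * Real.pi * I : ℂ) • (1 : A) := by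
  have hres : ∀ z : ℂ, 1 < ‖z‖ → z ∈ resolventSet ℂ T := fun z hz => by
    by_contra h
    have := hT h
    rw [mem_closedBall_zero_iff] at this
    linarith
  have hdiff : ∀ z : ℂ, 1 < ‖z‖ → DifferentiableAt ℂ (resolvent T) z := fun z hz =>
    (spectrum.hasDerivAt_resolvent_const_left (hres z hz)).differentiableAt
  have hlim := spectrum.resolvent_tendsto_cobounded (𝕜 := ℂ) T
  have hbound : ∀ ε > 0, ‖(∮ z in C(0, r), resolvent T z) - (2 * Real.pi * I : ℂ) • (1 : A)‖ ≤
      2 * Real.pi * (ε * ‖T‖) := by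
    intro ε hε
    have h1 := (Metric.tendsto_nhds.1 hlim) ε hε
    obtain ⟨R0, -, hR0⟩ := (Filter.hasBasis_cobounded_norm (E := ℂ)).eventually_iff.1 h1
    set R := max r R0
    have hR : 0 < R := by have := le_max_left r R0; linarith
    have hrR : r ≤ R := le_max_left _ _
    have hR1 : 1 < R := by linarith
    have heq := Complex.circleIntegral_eq_of_differentiable_on_annulus_off_countable (c := 0)
      (r := r) (R := R) (by linarith) hrR (f := resolvent T) Set.countable_empty
      (fun z hz => (hdiff z (by
        have := hz.2
        rw [mem_ball_zero_iff, not_lt] at this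
        linarith)).continuousAt.continuousWithinAt)
      (fun z hz => hdiff z (by
        have := hz.1.2
        rw [mem_closedBall_zero_iff, not_le] at this
        linarith))
    have hsplit : ∀ z : ℂ, ‖z‖ = R → resolvent T z =
        (z - 0)⁻¹ • (1 : A) + z⁻¹ • (T * resolvent T z) := by
      intro z hz
      have hz0 : z ≠ 0 := by rw [← norm_pos_iff, hz]; exact hR
      have hu := Ring.mul_inverse_cancel _ (spectrum.mem_resolventSet_iff.1 (hres z (by rwa [hz])))
      change (algebraMap ℂ A z - T) * resolvent T z = 1 at hu
      rw [sub_mul, ← Algebra.smul_def, sub_eq_iff_eq_add] at hu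
      rw [sub_zero, ← smul_add, ← hu, smul_smul, inv_mul_cancel₀ hz0, one_smul]
    have hcont : ContinuousOn (resolvent T) (sphere (0 : ℂ) R) := fun z hz =>
      (hdiff z (by rw [mem_sphere_zero_iff_norm.1 hz]; exact hR1)).continuousAt.continuousWithinAt
    have hinv : ContinuousOn (fun z : ℂ => z⁻¹) (sphere (0 : ℂ) R) :=
      continuousOn_inv₀.mono fun z hz => by
        have := mem_sphere_zero_iff_norm.1 hz
        rw [Set.mem_compl_iff, Set.mem_singleton_iff, ← norm_eq_zero]
        linarith
    have hI1 : CircleIntegrable (fun z : ℂ => (z - 0)⁻¹ • (1 : A)) 0 R := by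
      refine ContinuousOn.circleIntegrable hR.le ?_
      simp only [sub_zero]
      exact hinv.smul continuousOn_const
    have hI2 : CircleIntegrable (fun z : ℂ => z⁻¹ • (T * resolvent T z)) 0 R :=
      ContinuousOn.circleIntegrable hR.le (hinv.smul (continuousOn_const.mul hcont))
    rw [← heq, circleIntegral.integral_congr hR.le
      (fun z hz => hsplit z (mem_sphere_zero_iff_norm.1 hz)),
      circleIntegral.integral_add hI1 hI2, circleIntegral.integral_smul_const,
      circleIntegral.integral_sub_center_inv _ hR.ne', add_sub_cancel_left]
    refine (circleIntegral.norm_integral_le_of_norm_le_const hR.le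
      (C := R⁻¹ * (ε * ‖T‖)) fun z hz => ?_).trans_eq (by field_simp)
    have hzR := mem_sphere_zero_iff_norm.1 hz
    rw [norm_smul, norm_inv, hzR]
    have h2 : dist (resolvent T z) 0 < ε := hR0 (by
      change R0 ≤ ‖z‖
      rw [hzR]; exact le_max_right _ _)
    rw [dist_zero_right] at h2
    gcongr
    calc ‖T * resolvent T z‖ ≤ ‖T‖ * ‖resolvent T z‖ := norm_mul_le _ _
      _ ≤ ε * ‖T‖ := by rw [mul_comm]; gcongr
  rw [← sub_eq_zero, ← norm_le_zero_iff]
  refine le_of_forall_pos_le_add fun δ hδ => ?_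
  have hpos : 0 < 2 * Real.pi * (‖T‖ + 1) := by positivity
  refine (hbound (δ / (2 * Real.pi * (‖T‖ + 1))) (by positivity)).trans ?_
  rw [zero_add]
  have : 2 * Real.pi * (δ / (2 * Real.pi * (‖T‖ + 1)) * ‖T‖) = δ * (‖T‖ / (‖T‖ + 1)) := by
    field_simp
  rw [this]
  exact mul_le_of_le_one_right hδ.le ((div_le_one (by positivity)).2 (by linarith))

/-- The Cauchy integral does not depend on the admissible radius, and its value is the expected
rational function of `T`. -/
theorem holCalculus_moebius [CompleteSpace A] {T : A} (hT : spectrum ℂ T ⊆ closedBall 0 1)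
    (theta : ℝ) (a : 𝔻) {r : ℝ} (hr : 1 < r) (hra : r * ‖(a : ℂ)‖ < 1) :
    holCalculus (moebius theta a) T r =
      exp (theta * I) •
        (Ring.inverse (1 - conj (a : ℂ) • T) * (T - algebraMap ℂ A (a : ℂ))) := by
  set e := exp (theta * I)
  set b := conj (a : ℂ) with hb
  have hnb : ‖b‖ = ‖(a : ℂ)‖ := RCLike.norm_conj _
  have hr0 : 0 < r := by linarith
  have hU : IsUnit (1 - b • T) := by
    by_cases h0 : b = 0
    · simp [h0]
    · have h1 : b⁻¹ ∈ resolventSet ℂ T := by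
        by_contra h
        have := hT h
        rw [mem_closedBall_zero_iff, norm_inv, hnb] at this
        have h2 : 0 < ‖(a : ℂ)‖ := by rw [← hnb]; exact norm_pos_iff.2 h0
        have h3 := inv_mul_cancel₀ h2.ne'
        have h4 := a.norm_lt_one
        nlinarith
      have h2 := spectrum.mem_resolventSet_iff.1 h1
      have h3 : 1 - b • T = b • (algebraMap ℂ A b⁻¹ - T) := by
        rw [smul_sub, Algebra.algebraMap_eq_smul_one, smul_smul, mul_inv_cancel₀ h0, one_smul]
      rw [h3]
      exact h2.smul (Units.mk0 b h0)
  set S := Ring.inverse (1 - b • T) with hS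
  have hSU : S * (1 - b • T) = 1 := Ring.inverse_mul_cancel _ hU
  have hd : ∀ z : ℂ, ‖z‖ ≤ r → 1 - b * z ≠ 0 := by
    intro z hz h
    have h1 : ‖b * z‖ = 1 := by rw [← sub_eq_zero.1 h, norm_one]
    rw [norm_mul, hnb] at h1
    nlinarith [norm_nonneg (a : ℂ)]
  have hsplit : ∀ z : ℂ, ‖z‖ = r → moebius theta a z • resolvent T z =
      (e • (S * (T - algebraMap ℂ A (a : ℂ)))) * resolvent T z +
        (1 - b * z)⁻¹ • ((e * (1 - b * a)) • S) := by
    intro z hz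
    have hdz := hd z hz.le
    have hzr : IsUnit (algebraMap ℂ A z - T) := by
      by_contra h
      have := hT (show z ∈ spectrum ℂ T from fun h' => h (spectrum.mem_resolventSet_iff.1 h'))
      rw [mem_closedBall_zero_iff] at this
      linarith
    have hW : (algebraMap ℂ A z - T) * resolvent T z = 1 := Ring.mul_inverse_cancel _ hzr
    have h1 : resolvent T z = S * (1 - b • T) * resolvent T z := by rw [hSU, one_mul]
    have h2 : S = S * (algebraMap ℂ A z - T) * resolvent T z := by rw [mul_assoc, hW, mul_one]
    have h3 : moebius theta a z • (1 - b • T) = e • (T - algebraMap ℂ A (a : ℂ)) +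
        ((1 - b * z)⁻¹ * (e * (1 - b * a))) • (algebraMap ℂ A z - T) := by
      have hm : moebius theta a z = (1 - b * z)⁻¹ * (e * (z - a)) := by
        rw [moebius, div_eq_inv_mul]; ring
      have hdi := inv_mul_cancel₀ hdz
      rw [hm]
      simp only [Algebra.algebraMap_eq_smul_one]
      have he : e = (1 - b * z)⁻¹ * (e * (1 - b * z)) := by field_simp
      have he' : e • (T - (a : ℂ) • (1 : A)) =
          ((1 - b * z)⁻¹ * (e * (1 - b * z))) • (T - (a : ℂ) • (1 : A)) := by rw [← he]
      rw [he']
      module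
    calc moebius theta a z • resolvent T z
        = S * (moebius theta a z • (1 - b • T)) * resolvent T z := by
          rw [mul_smul_comm, smul_mul_assoc, ← h1]
      _ = (e • (S * (T - algebraMap ℂ A (a : ℂ)))) * resolvent T z +
          ((1 - b * z)⁻¹ * (e * (1 - b * a))) •
            (S * (algebraMap ℂ A z - T) * resolvent T z) := by
          rw [h3, mul_add, add_mul, mul_smul_comm, mul_smul_comm, smul_mul_assoc, smul_mul_assoc]
      _ = _ := by rw [← h2, smul_smul]
  have hcont : ContinuousOn (resolvent T) (sphere (0 : ℂ) r) := fun z hz => by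
    have hz' : z ∈ resolventSet ℂ T := by
      by_contra h
      have := hT h
      rw [mem_closedBall_zero_iff, mem_sphere_zero_iff_norm.1 hz] at this
      linarith
    exact (spectrum.hasDerivAt_resolvent_const_left hz').continuousAt.continuousWithinAt
  have hinvd : DifferentiableOn ℂ (fun z : ℂ => (1 - b * z)⁻¹) (closedBall 0 r) := fun z hz =>
    DifferentiableAt.differentiableWithinAt
      (DifferentiableAt.inv (by fun_prop) (hd z (mem_closedBall_zero_iff.1 hz)))
  have hI1 : CircleIntegrable (fun z : ℂ => (e • (S * (T - algebraMap ℂ A (a : ℂ)))) *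
      resolvent T z) 0 r :=
    ContinuousOn.circleIntegrable hr0.le (continuousOn_const.mul hcont)
  have hI2 : CircleIntegrable (fun z : ℂ => (1 - b * z)⁻¹ • ((e * (1 - b * a)) • S)) 0 r :=
    ContinuousOn.circleIntegrable hr0.le
      ((hinvd.continuousOn.mono sphere_subset_closedBall).smul continuousOn_const)
  have hzero : (∮ z in C(0, r), (1 - b * z)⁻¹) = 0 :=
    DiffContOnCl.circleIntegral_eq_zero hr0.le
      (hinvd.diffContOnCl_ball subset_rfl)
  have hmul : (∮ z in C(0, r), (e • (S * (T - algebraMap ℂ A (a : ℂ)))) * resolvent T z) =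
      (e • (S * (T - algebraMap ℂ A (a : ℂ)))) * ∮ z in C(0, r), resolvent T z := by
    have hint : CircleIntegrable (resolvent T) 0 r := hcont.circleIntegrable hr0.le
    have := (ContinuousLinearMap.mul ℂ A (e • (S * (T - algebraMap ℂ A (a : ℂ))))
      ).intervalIntegral_comp_comm hint.out
    simpa [circleIntegral] using this
  rw [holCalculus, circleIntegral.integral_congr hr0.le
    (fun z hz => hsplit z (mem_sphere_zero_iff_norm.1 hz)),
    circleIntegral.integral_add hI1 hI2, circleIntegral.integral_smul_const, hzero, zero_smul,
    add_zero, hmul, circleIntegral_resolvent hT hr, mul_smul_comm, mul_one, smul_smul,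
    inv_mul_cancel₀ Complex.two_pi_I_ne_zero, one_smul]

theorem moebiusCalculus_eq [CompleteSpace A] {T : A} (hT : spectrum ℂ T ⊆ closedBall 0 1)
    (theta : ℝ) (a : 𝔻) :
    moebiusCalculus theta a T = exp (theta * I) •
      (Ring.inverse (1 - conj (a : ℂ) • T) * (T - algebraMap ℂ A (a : ℂ))) := by
  have h1 := a.norm_lt_one
  have h0 := norm_nonneg (a : ℂ)
  refine holCalculus_moebius hT theta a ?_ ?_
  · rw [lt_div_iff₀ (by positivity)]; linarith
  · rw [div_mul_eq_mul_div, div_lt_one (by positivity)]; linarith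

end FunctionalCalculus

section WeaklyHomogeneous

variable {H : Type*} [NormedAddCommGroup H] [InnerProductSpace ℂ H]

/-- Similarity of bounded operators: `L S L⁻¹ = T` for a bounded invertible operator `L`. -/
def IsSimilar (S T : H →L[ℂ] H) : Prop :=
  ∃ L : H ≃L[ℂ] H, L.toContinuousLinearMap ∘L S ∘L L.symm.toContinuousLinearMap = T

/-- `T` is weakly homogeneous: its spectrum lies in the closed unit disc, and `φ(T)` is similar to
`T` for every `φ` in the Moebius group. -/
def WeaklyHomogeneous (T : H →L[ℂ] H) : Prop :=
  spectrum ℂ T ⊆ closedBall 0 1 ∧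
    ∀ (theta : ℝ) (a : 𝔻), IsSimilar (moebiusCalculus theta a T) T

end WeaklyHomogeneous

end

open scoped InnerProductSpace

/-! ### Kernel functions and positive kernels -/

/-- The kernel `(1 - z * conj w) ^ (-lam)` as a complex-valued function. -/
noncomputable def kerVal (lam : ℝ≥0) (z w : ℂ) : ℂ := 1 / (1 - z * conj w) ^ ((lam : ℝ) : ℂ)

/-- The kernel function of `H^(lam)` at the point `w`. -/
noncomputable def kern (lam : ℝ≥0) (w : 𝔻) : DiscSpace lam := RKHS.kerFun (DiscSpace lam) w (1 : ℂ)

theorem inner_kern {lam : ℝ≥0} (f : DiscSpace lam) (w : 𝔻) : ⟪kern lam w, f⟫_ℂ = f w := by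
  simp [kern]

theorem kern_apply (lam : ℝ≥0) (w z : 𝔻) : kern lam w z = kerVal lam z w := by
  rw [kern, RKHS.kerFun_apply, kernel_discSpace]
  simp [discKernel, kerVal]

theorem span_kern_dense (lam : ℝ≥0) :
    Dense (Submodule.span ℂ (Set.range (kern lam)) : Set (DiscSpace lam)) := by
  rw [Submodule.dense_iff_topologicalClosure_eq_top, eq_top_iff,
    ← RKHS.kerFun_dense (H := DiscSpace lam)]
  refine Submodule.topologicalClosure_mono (Submodule.span_le.2 ?_)
  rintro _ ⟨x, v, rfl⟩
  have : RKHS.kerFun (DiscSpace lam) x v = v • kern lam x := by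
    rw [kern, ← map_smul, smul_eq_mul, mul_one]
  rw [this]
  exact Submodule.smul_mem _ _ (Submodule.subset_span ⟨x, rfl⟩)

theorem clm_ext_kern {lam : ℝ≥0} {E : Type*} [NormedAddCommGroup E] [NormedSpace ℂ E]
    {A B : DiscSpace lam →L[ℂ] E} (h : ∀ w, A (kern lam w) = B (kern lam w)) : A = B := by
  refine ContinuousLinearMap.ext_on (span_kern_dense lam) ?_
  rintro _ ⟨w, rfl⟩
  exact h w

/-- Positive semidefiniteness of a scalar kernel on the unit disc. -/
def PosKernel (k : 𝔻 → 𝔻 → ℂ) : Prop :=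
  ∀ (s : Finset 𝔻) (v : 𝔻 → ℂ), 0 ≤ (∑ x ∈ s, ∑ y ∈ s, conj (v x) * v y * k x y).re

theorem re_sum_inner_eq_norm_sq {E : Type*} [NormedAddCommGroup E] [InnerProductSpace ℂ E]
    (γ : 𝔻 → E) (s : Finset 𝔻) (v : 𝔻 → ℂ) :
    (∑ x ∈ s, ∑ y ∈ s, conj (v x) * v y * ⟪γ x, γ y⟫_ℂ).re = ‖∑ x ∈ s, v x • γ x‖ ^ 2 := by
  rw [← inner_self_eq_norm_sq (𝕜 := ℂ), sum_inner]
  refine congrArg Complex.re (Finset.sum_congr rfl fun x _ => ?_)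
  rw [inner_sum]
  refine Finset.sum_congr rfl fun y _ => ?_
  rw [inner_smul_left, inner_smul_right, mul_assoc]

theorem inner_kern_kern (lam : ℝ≥0) (x y : 𝔻) : ⟪kern lam x, kern lam y⟫_ℂ = kerVal lam x y := by
  rw [inner_kern, kern_apply]

theorem exists_clm_of_posKernel {lam : ℝ≥0} {E : Type*} [NormedAddCommGroup E]
    [InnerProductSpace ℂ E] [CompleteSpace E] (γ : 𝔻 → E) {C : ℝ} (hC : 0 ≤ C)
    (h : PosKernel fun x y => C ^ 2 * kerVal lam x y - ⟪γ x, γ y⟫_ℂ) :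
    ∃ A : DiscSpace lam →L[ℂ] E, ‖A‖ ≤ C ∧ ∀ w, A (kern lam w) = γ w := by
  have hd : DenseRange (Finsupp.linearCombination ℂ (kern lam)) := by
    rw [DenseRange, ← LinearMap.coe_range, Finsupp.range_linearCombination]
    exact span_kern_dense lam
  have hn : ∀ v : 𝔻 →₀ ℂ, ‖Finsupp.linearCombination ℂ γ v‖ ≤
      C * ‖Finsupp.linearCombination ℂ (kern lam) v‖ := by
    intro v
    rw [← sq_le_sq₀ (norm_nonneg _) (by positivity), mul_pow]
    simp only [Finsupp.linearCombination_apply, Finsupp.sum]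
    rw [← re_sum_inner_eq_norm_sq, ← re_sum_inner_eq_norm_sq]
    have h1 := h v.support v
    have h2 : ∑ x ∈ v.support, ∑ y ∈ v.support, conj (v x) * v y *
        (C ^ 2 * kerVal lam x y - ⟪γ x, γ y⟫_ℂ) =
        ((C ^ 2 : ℝ) : ℂ) * (∑ x ∈ v.support, ∑ y ∈ v.support,
          conj (v x) * v y * ⟪kern lam x, kern lam y⟫_ℂ) -
        ∑ x ∈ v.support, ∑ y ∈ v.support, conj (v x) * v y * ⟪γ x, γ y⟫_ℂ := by
      simp only [Finset.mul_sum, ← Finset.sum_sub_distrib, inner_kern_kern]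
      refine Finset.sum_congr rfl fun x _ => Finset.sum_congr rfl fun y _ => ?_
      push_cast
      ring
    rw [h2, sub_re, re_ofReal_mul] at h1
    linarith
  refine ⟨(Finsupp.linearCombination ℂ γ).extendOfNorm (Finsupp.linearCombination ℂ (kern lam)),
    LinearMap.opNorm_extendOfNorm_le hd hC hn, fun w => ?_⟩
  have := LinearMap.extendOfNorm_eq hd ⟨C, hn⟩ (Finsupp.single w 1)
  simpa using this

/-- A weighted composition operator `f ↦ h * (f ∘ φ)` is bounded if its kernel inequality holds. -/
theorem exists_weighted_comp {lam mu : ℝ≥0} (φ : 𝔻 → 𝔻) (h : 𝔻 → ℂ) {C : ℝ} (hC : 0 ≤ C)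
    (hp : PosKernel fun x y =>
      C ^ 2 * kerVal mu x y - h x * conj (h y) * kerVal lam (φ x) (φ y)) :
    ∃ A : DiscSpace lam →L[ℂ] DiscSpace mu, ‖A‖ ≤ C ∧ ∀ f z, A f z = h z * f (φ z) := by
  obtain ⟨A, hA, hk⟩ := exists_clm_of_posKernel (lam := mu)
    (fun w => conj (h w) • kern lam (φ w)) hC (by
      convert! hp using 5 with x y
      rw [inner_smul_left, inner_smul_right, inner_kern_kern, conj_conj]
      ring)
  refine ⟨ContinuousLinearMap.adjoint A, by rwa [LinearIsometryEquiv.norm_map], fun f z => ?_⟩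
  rw [← inner_kern, ContinuousLinearMap.adjoint_inner_right, hk, inner_smul_left, inner_kern,
    conj_conj]

theorem PosKernel.add {k l : 𝔻 → 𝔻 → ℂ} (hk : PosKernel k) (hl : PosKernel l) :
    PosKernel fun x y => k x y + l x y := by
  intro s v
  have := add_nonneg (hk s v) (hl s v)
  simpa [mul_add, Finset.sum_add_distrib] using this

theorem PosKernel.conj_mul {k : 𝔻 → 𝔻 → ℂ} (hk : PosKernel k) (h : 𝔻 → ℂ) :
    PosKernel fun x y => h x * conj (h y) * k x y := by
  intro s v
  convert hk s fun x => conj (h x) * v x using 4 with x _ y _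
  simp only [map_mul, conj_conj]
  ring

theorem PosKernel.ofReal_mul {k : 𝔻 → 𝔻 → ℂ} (hk : PosKernel k) {c : ℝ} (hc : 0 ≤ c) :
    PosKernel fun x y => c * k x y := by
  intro s v
  have h : ∑ x ∈ s, ∑ y ∈ s, conj (v x) * v y * (c * k x y) =
      (c : ℂ) * ∑ x ∈ s, ∑ y ∈ s, conj (v x) * v y * k x y := by
    simp only [Finset.mul_sum]
    refine Finset.sum_congr rfl fun x _ => Finset.sum_congr rfl fun y _ => ?_
    ring
  rw [h, re_ofReal_mul]
  exact mul_nonneg hc (hk s v)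

/-- Products of a positive kernel with a power series in `x * conj y` with nonnegative coefficients
are positive. -/
theorem PosKernel.mul_of_hasSum {k : 𝔻 → 𝔻 → ℂ} (hk : PosKernel k) {c : ℕ → ℝ}
    (hc : ∀ n, 0 ≤ c n) {F : 𝔻 → 𝔻 → ℂ}
    (hF : ∀ x y : 𝔻, HasSum (fun n => (c n : ℂ) * ((x : ℂ) * conj (y : ℂ)) ^ n) (F x y)) :
    PosKernel fun x y => F x y * k x y := by
  intro s v
  have h : HasSum (fun n => ∑ x ∈ s, ∑ y ∈ s, conj (v x) * v y *
      (c n * (((x : ℂ) ^ n * conj ((y : ℂ) ^ n)) * k x y)))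
      (∑ x ∈ s, ∑ y ∈ s, conj (v x) * v y * (F x y * k x y)) := by
    refine hasSum_sum fun x _ => hasSum_sum fun y _ => ?_
    convert! ((hF x y).mul_right (k x y)).mul_left (conj (v x) * v y) using 2 with n
    rw [mul_pow, map_pow]
    ring
  exact ((Complex.hasSum_iff _ _).1 h).1.nonneg fun n =>
    ((hk.conj_mul fun x => (x : ℂ) ^ n).ofReal_mul (hc n)) s v

theorem PosKernel.kerVal_mul {k : 𝔻 → 𝔻 → ℂ} (hk : PosKernel k) (nu : ℝ≥0) :
    PosKernel fun x y => kerVal nu x y * k x y :=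
  hk.mul_of_hasSum (choose_nonneg nu) fun x y =>
    hasSum_discKernel nu (norm_coe_mul_conj_lt_one x y)

theorem PosKernel.kerVal_sub_one_mul {k : 𝔻 → 𝔻 → ℂ} (hk : PosKernel k) (nu : ℝ≥0) :
    PosKernel fun x y => (kerVal nu x y - 1) * k x y := by
  refine hk.mul_of_hasSum (c := fun n => if n = 0 then 0 else Ring.choose ((nu : ℝ) + n - 1) n)
    (fun n => ?_) fun x y => ?_
  · split_ifs
    · exact le_rfl
    · exact choose_nonneg nu n
  · have h := (hasSum_discKernel nu (norm_coe_mul_conj_lt_one x y)).sub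
      (hasSum_ite_eq (0 : ℕ) (1 : ℂ))
    convert! h using 2 with n
    rcases eq_or_ne n 0 with rfl | hn
    · simp
    · simp [hn]

theorem posKernel_kerVal (lam : ℝ≥0) : PosKernel fun x y => kerVal lam x y := by
  intro s v
  simp only [← inner_kern_kern]
  rw [re_sum_inner_eq_norm_sq]
  positivity

theorem one_sub_mul_conj_ne_zero (x y : 𝔻) : (1 : ℂ) - x * conj (y : ℂ) ≠ 0 := by
  intro h
  have := norm_coe_mul_conj_lt_one x y
  rw [← sub_eq_zero.1 h, norm_one] at this
  exact lt_irrefl _ this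

theorem kerVal_add (lam mu : ℝ≥0) (x y : 𝔻) :
    kerVal (lam + mu) x y = kerVal lam x y * kerVal mu x y := by
  simp only [kerVal]
  rw [NNReal.coe_add, ofReal_add, cpow_add _ _ (one_sub_mul_conj_ne_zero x y), one_div_mul_one_div]

/-! ### Multipliers -/

theorem one_sub_mul_conj_ne_zero' {z : ℂ} (hz : ‖z‖ ≤ 1) (w : 𝔻) : 1 - z * conj (w : ℂ) ≠ 0 := by
  intro h
  have h1 : ‖z * conj (w : ℂ)‖ = 1 := by rw [← sub_eq_zero.1 h, norm_one]
  rw [norm_mul, RCLike.norm_conj] at h1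
  nlinarith [w.norm_lt_one, norm_nonneg (w : ℂ), norm_nonneg z]

theorem closure_unitBall : closure (ball (0 : ℂ) 1) = closedBall 0 1 :=
  closure_ball _ one_ne_zero

theorem diffContOnCl_szego (w : 𝔻) :
    DiffContOnCl ℂ (fun z : ℂ => (1 - z * conj (w : ℂ))⁻¹) (ball 0 1) := by
  refine DiffContOnCl.inv (Differentiable.diffContOnCl (by fun_prop)) fun z hz => ?_
  rw [closure_unitBall, mem_closedBall_zero_iff] at hz
  exact one_sub_mul_conj_ne_zero' hz w

theorem DiffContOnCl.mul' {f g : ℂ → ℂ} {s : Set ℂ} (hf : DiffContOnCl ℂ f s)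
    (hg : DiffContOnCl ℂ g s) : DiffContOnCl ℂ (fun z => f z * g z) s := hf.smul hg

theorem diffContOnCl_sum_szego (s : Finset 𝔻) (v : 𝔻 → ℂ) :
    DiffContOnCl ℂ (fun z : ℂ => ∑ x ∈ s, v x * (1 - z * conj (x : ℂ))⁻¹) (ball 0 1) :=
  ⟨DifferentiableOn.fun_sum fun x _ => ((diffContOnCl_szego x).1.const_mul (v x)),
    continuousOn_finsetSum s fun x _ => (diffContOnCl_szego x).2.const_mul (v x)⟩

theorem DiffContOnCl.continuousOn_sphere {f : ℂ → ℂ} (hf : DiffContOnCl ℂ f (ball 0 1)) :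
    ContinuousOn f (sphere 0 1) :=
  hf.continuousOn_ball.mono sphere_subset_closedBall

theorem circleIntegrable_mul_conj {f g : ℂ → ℂ} (hf : DiffContOnCl ℂ f (ball 0 1))
    (hg : DiffContOnCl ℂ g (ball 0 1)) : CircleIntegrable (fun z => f z * conj (g z)) 0 1 :=
  (hf.continuousOn_sphere.mul
    (continuous_conj.comp_continuousOn hg.continuousOn_sphere)).circleIntegrable zero_le_one

/-- The reproducing property of the Szegő kernel. -/
theorem circleAverage_mul_conj_szego {g : ℂ → ℂ} (hg : DiffContOnCl ℂ g (ball 0 1)) (w : 𝔻) :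
    Real.circleAverage (fun z => g z * conj ((1 - z * conj (w : ℂ))⁻¹)) 0 1 = g w := by
  rw [Real.circleAverage_eq_circleIntegral one_ne_zero,
    ← hg.two_pi_i_inv_smul_circleIntegral_sub_inv_smul (mem_ball_zero_iff.2 w.norm_lt_one)]
  congr 1
  refine circleIntegral.integral_congr zero_le_one fun z hz => ?_
  have hz1 : ‖z‖ = 1 := mem_sphere_zero_iff_norm.1 hz
  have hz0 : z ≠ 0 := by rw [← norm_pos_iff, hz1]; exact one_pos
  have hzc : z * conj z = 1 := by rw [mul_conj, normSq_eq_norm_sq, hz1]; simp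
  have h1 : (1 - conj z * (w : ℂ)) = z⁻¹ * (z - w) := by
    rw [← eq_inv_of_mul_eq_one_right hzc]
    linear_combination -hzc
  simp only [sub_zero, smul_eq_mul, map_inv₀, map_sub, map_one, map_mul, conj_conj, h1, mul_inv,
    inv_inv]
  field_simp

theorem circleAverage_mul_conj_sum_szego {g : ℂ → ℂ} (hg : DiffContOnCl ℂ g (ball 0 1))
    (s : Finset 𝔻) (v : 𝔻 → ℂ) :
    Real.circleAverage (fun z => g z * conj (∑ x ∈ s, v x * (1 - z * conj (x : ℂ))⁻¹)) 0 1 =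
      ∑ x ∈ s, conj (v x) * g x := by
  have h : (fun z => g z * conj (∑ x ∈ s, v x * (1 - z * conj (x : ℂ))⁻¹)) =
      fun z => ∑ x ∈ s, conj (v x) • (g z * conj ((1 - z * conj (x : ℂ))⁻¹)) := by
    ext z
    rw [map_sum, Finset.mul_sum]
    refine Finset.sum_congr rfl fun x _ => ?_
    rw [map_mul, smul_eq_mul]
    ring
  rw [h, Real.circleAverage_fun_sum
    (f := fun (x : 𝔻) z => conj (v x) • (g z * conj ((1 - z * conj (x : ℂ))⁻¹)))
    fun x _ => (circleIntegrable_mul_conj hg (diffContOnCl_szego x)).const_smul]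
  refine Finset.sum_congr rfl fun x _ => ?_
  rw [Real.circleAverage_fun_smul, circleAverage_mul_conj_szego hg, smul_eq_mul]

theorem posKernel_szego_sub {psi : ℂ → ℂ} (hpsi : DiffContOnCl ℂ psi (ball 0 1)) {c : ℝ}
    (hc : ∀ z : ℂ, ‖z‖ = 1 → ‖psi z‖ ≤ c) :
    PosKernel fun x y => (c ^ 2 - psi x * conj (psi y)) * (1 - (x : ℂ) * conj (y : ℂ))⁻¹ := by
  intro s v
  set F : ℂ → ℂ := fun z => ∑ x ∈ s, v x * (1 - z * conj (x : ℂ))⁻¹ with hF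
  set G : ℂ → ℂ := fun z => ∑ x ∈ s, (v x * conj (psi x)) * (1 - z * conj (x : ℂ))⁻¹ with hG
  have hFd : DiffContOnCl ℂ F (ball 0 1) := diffContOnCl_sum_szego s v
  have hGd : DiffContOnCl ℂ G (ball 0 1) := diffContOnCl_sum_szego s _
  set g : ℂ → ℂ := fun z => (c : ℂ) ^ 2 * F z - 2 * (psi z * G z) with hg
  have hgd : DiffContOnCl ℂ g (ball 0 1) :=
    (diffContOnCl_const.mul' hFd).sub (diffContOnCl_const.mul' (hpsi.mul' hGd))
  have h1 := circleAverage_mul_conj_sum_szego hgd s v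
  have h2 := circleAverage_mul_conj_sum_szego hGd s fun x => v x * conj (psi x)
  have hi1 := circleIntegrable_mul_conj hgd hFd
  have hi2 := circleIntegrable_mul_conj hGd hGd
  have h3 := Real.circleAverage_fun_add hi1 hi2
  rw [h1, h2] at h3
  have h4 := reCLM.circleAverage_comp_comm (hi1.add hi2)
  have h5 : 0 ≤ Real.circleAverage
      (reCLM ∘ fun z => g z * conj (F z) + G z * conj (G z)) 0 1 := by
    refine Real.circleAverage_nonneg_of_nonneg fun z hz => ?_
    rw [abs_one, mem_sphere_zero_iff_norm] at hz
    have e1 : (g z * conj (F z) + G z * conj (G z)).re =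
        (c ^ 2 - ‖psi z‖ ^ 2) * ‖F z‖ ^ 2 + ‖conj (psi z) * F z - G z‖ ^ 2 := by
      rw [← normSq_eq_norm_sq, ← normSq_eq_norm_sq, ← normSq_eq_norm_sq]
      simp only [hg, normSq_apply, sq]
      simp
      ring
    change 0 ≤ (g z * conj (F z) + G z * conj (G z)).re
    rw [e1]
    have := pow_le_pow_left₀ (norm_nonneg _) (hc z hz) 2
    have : 0 ≤ c ^ 2 - ‖psi z‖ ^ 2 := by linarith
    positivity
  have h6 : ∑ x ∈ s, ∑ y ∈ s, conj (v x) * v y *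
      ((c ^ 2 - psi x * conj (psi y)) * (1 - (x : ℂ) * conj (y : ℂ))⁻¹) =
      ∑ x ∈ s, conj (v x) * g x + ∑ x ∈ s, conj (v x * conj (psi x)) * G x := by
    rw [← Finset.sum_add_distrib]
    refine Finset.sum_congr rfl fun x _ => ?_
    have : conj (v x) * g x + conj (v x * conj (psi x)) * G x =
      conj (v x) * (c ^ 2 * F x - psi x * G x) := by
      simp only [hg, map_mul, conj_conj]
      ring
    rw [this, hF, hG]
    simp only [Finset.mul_sum, ← Finset.sum_sub_distrib]
    refine Finset.sum_congr rfl fun y _ => ?_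
    ring
  rw [h6, ← h3]
  exact h5.trans_eq h4

theorem kerVal_one (x y : ℂ) : kerVal 1 x y = (1 - x * conj y)⁻¹ := by
  simp [kerVal]

theorem posKernel_multiplier {lam mu : ℝ≥0} (hlam : 1 ≤ lam) (hmu : lam ≤ mu) {psi : ℂ → ℂ}
    (hpsi : DiffContOnCl ℂ psi (ball 0 1)) {c : ℝ} (hc : ∀ z : ℂ, ‖z‖ = 1 → ‖psi z‖ ≤ c) :
    PosKernel fun x y => c ^ 2 * kerVal mu x y - psi x * conj (psi y) * kerVal lam x y := by
  obtain ⟨a, rfl⟩ := exists_add_of_le hlam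
  obtain ⟨b, rfl⟩ := exists_add_of_le hmu
  have h1 := (posKernel_szego_sub hpsi hc).kerVal_mul a
  have h2 := ((posKernel_kerVal (1 + a)).kerVal_sub_one_mul b).ofReal_mul (sq_nonneg c)
  convert h1.add h2 using 3 with x y
  rw [kerVal_add, kerVal_add, kerVal_one]
  push_cast
  ring

theorem exists_multiplier {lam mu : ℝ≥0} (hlam : 1 ≤ lam) (hmu : lam ≤ mu) {psi : ℂ → ℂ}
    (hpsi : DiffContOnCl ℂ psi (ball 0 1)) {c : ℝ} (hc : ∀ z : ℂ, ‖z‖ = 1 → ‖psi z‖ ≤ c) :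
    ∃ A : DiscSpace lam →L[ℂ] DiscSpace mu, ‖A‖ ≤ c ∧ ∀ f, ∀ z : 𝔻, A f z = psi z * f z :=
  exists_weighted_comp id (fun z => psi z) ((norm_nonneg _).trans (hc 1 norm_one))
    (posKernel_multiplier hlam hmu hpsi hc)

theorem isMultiplier_of_diffContOnCl {lam mu : ℝ≥0} (hlam : 1 ≤ lam) (hmu : lam ≤ mu)
    {psi : ℂ → ℂ} (hpsi : DiffContOnCl ℂ psi (ball 0 1)) : IsMultiplier lam mu psi := by
  obtain ⟨c, hc⟩ := (isCompact_sphere (0 : ℂ) 1).exists_bound_of_continuousOn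
    hpsi.continuousOn_sphere
  obtain ⟨A, -, hA⟩ := exists_multiplier hlam hmu hpsi fun z hz =>
    hc z (mem_sphere_zero_iff_norm.2 hz)
  exact ⟨A, hA⟩

theorem norm_mulOp_le {lam mu : ℝ≥0} (hlam : 1 ≤ lam) (hmu : lam ≤ mu) {psi : ℂ → ℂ}
    (hpsi : DiffContOnCl ℂ psi (ball 0 1)) {c : ℝ} (hc : ∀ z : ℂ, ‖z‖ = 1 → ‖psi z‖ ≤ c) :
    ‖mulOp lam mu psi‖ ≤ c := by
  obtain ⟨A, hA, hA'⟩ := exists_multiplier hlam hmu hpsi hc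
  convert hA
  ext f z
  rw [mulOp_apply ⟨A, hA'⟩, hA']

theorem mulOp_apply' {lam mu : ℝ≥0} (hlam : 1 ≤ lam) (hmu : lam ≤ mu) {psi : ℂ → ℂ}
    (hpsi : DiffContOnCl ℂ psi (ball 0 1)) (f : DiscSpace lam) (z : 𝔻) :
    mulOp lam mu psi f z = psi z * f z :=
  mulOp_apply (isMultiplier_of_diffContOnCl hlam hmu hpsi) f z

theorem diffContOnCl_id' : DiffContOnCl ℂ (fun z : ℂ => z) (ball 0 1) :=
  differentiable_id.diffContOnCl

/-! ### Moebius transformations and composition operators -/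

theorem moebius_denom_ne_zero (a : 𝔻) {z : ℂ} (hz : ‖z‖ ≤ 1) : 1 - conj (a : ℂ) * z ≠ 0 := by
  rw [mul_comm]
  exact one_sub_mul_conj_ne_zero' hz a

theorem re_moebius_denom_pos (a : 𝔻) {z : ℂ} (hz : ‖z‖ ≤ 1) : 0 < (1 - conj (a : ℂ) * z).re := by
  have h : ‖conj (a : ℂ) * z‖ < 1 := by
    rw [norm_mul, RCLike.norm_conj]
    nlinarith [a.norm_lt_one, norm_nonneg (a : ℂ), norm_nonneg z]
  have := (re_le_norm (conj (a : ℂ) * z)).trans_lt h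
  simpa using this

theorem exp_mul_conj_exp (theta : ℝ) : exp (theta * I) * conj (exp (theta * I)) = 1 := by
  rw [mul_conj, normSq_eq_norm_sq, norm_exp_ofReal_mul_I]
  simp

theorem one_sub_moebius_mul_conj (theta : ℝ) (a : 𝔻) {z w : ℂ} (hz : ‖z‖ ≤ 1) (hw : ‖w‖ ≤ 1) :
    (1 - moebius theta a z * conj (moebius theta a w)) * (1 - conj (a : ℂ) * z) *
      conj (1 - conj (a : ℂ) * w) = ((1 - ‖(a : ℂ)‖ ^ 2 : ℝ) : ℂ) * (1 - z * conj w) := by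
  have h1 := moebius_denom_ne_zero a hz
  have h2 : conj (1 - conj (a : ℂ) * w) ≠ 0 :=
    (map_ne_zero _).2 (moebius_denom_ne_zero a hw)
  have h3 := exp_mul_conj_exp theta
  have h4 : (a : ℂ) * conj (a : ℂ) = ((‖(a : ℂ)‖ ^ 2 : ℝ) : ℂ) := by
    rw [mul_conj, normSq_eq_norm_sq]
  have h5 : moebius theta a z * (1 - conj (a : ℂ) * z) = exp (theta * I) * (z - a) := by
    rw [moebius, mul_assoc, div_mul_cancel₀ _ h1]
  have h6 : conj (moebius theta a w) * conj (1 - conj (a : ℂ) * w) =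
      conj (exp (theta * I)) * conj (w - a) := by
    rw [← map_mul, moebius, mul_assoc, div_mul_cancel₀ _ (moebius_denom_ne_zero a hw), map_mul]
  have h7 : (1 - moebius theta a z * conj (moebius theta a w)) * (1 - conj (a : ℂ) * z) *
      conj (1 - conj (a : ℂ) * w) = (1 - conj (a : ℂ) * z) * conj (1 - conj (a : ℂ) * w) -
      (moebius theta a z * (1 - conj (a : ℂ) * z)) *
        (conj (moebius theta a w) * conj (1 - conj (a : ℂ) * w)) := by ring
  rw [h7, h5, h6, ofReal_sub, ← h4]
  simp only [map_sub, map_one, map_mul, conj_conj]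
  push_cast
  linear_combination (-(z - a) * (conj w - conj (a : ℂ))) * h3

theorem one_sub_norm_sq_moebius (theta : ℝ) (a : 𝔻) {z : ℂ} (hz : ‖z‖ ≤ 1) :
    (1 - ‖moebius theta a z‖ ^ 2) * ‖1 - conj (a : ℂ) * z‖ ^ 2 =
      (1 - ‖(a : ℂ)‖ ^ 2) * (1 - ‖z‖ ^ 2) := by
  have h := one_sub_moebius_mul_conj theta a hz hz
  rw [mul_assoc] at h
  simp only [mul_conj, normSq_eq_norm_sq] at h
  exact_mod_cast h

theorem norm_moebius_lt_one (theta : ℝ) (a : 𝔻) {z : ℂ} (hz : ‖z‖ < 1) :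
    ‖moebius theta a z‖ < 1 := by
  have h := one_sub_norm_sq_moebius theta a hz.le
  have h1 : 0 < ‖1 - conj (a : ℂ) * z‖ := norm_pos_iff.2 (moebius_denom_ne_zero a hz.le)
  have h2 : 0 < (1 - ‖(a : ℂ)‖ ^ 2) * (1 - ‖z‖ ^ 2) :=
    mul_pos (sub_pos.2 a.sq_norm_lt_one) (sub_pos.2 (by nlinarith [norm_nonneg z]))
  rw [← h] at h2
  have h3 := pos_of_mul_pos_left h2 (by positivity)
  nlinarith [norm_nonneg (moebius theta a z)]

theorem norm_moebius_eq_one (theta : ℝ) (a : 𝔻) {z : ℂ} (hz : ‖z‖ = 1) :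
    ‖moebius theta a z‖ = 1 := by
  have h := one_sub_norm_sq_moebius theta a hz.le
  have h1 : 0 < ‖1 - conj (a : ℂ) * z‖ := norm_pos_iff.2 (moebius_denom_ne_zero a hz.le)
  rw [hz, one_pow, sub_self, mul_zero] at h
  rcases mul_eq_zero.1 h with h | h
  · nlinarith [norm_nonneg (moebius theta a z)]
  · exact absurd h (by positivity)

theorem norm_moebius_le_one (theta : ℝ) (a : 𝔻) {z : ℂ} (hz : ‖z‖ ≤ 1) :
    ‖moebius theta a z‖ ≤ 1 := by
  rcases hz.lt_or_eq with h | h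
  · exact (norm_moebius_lt_one theta a h).le
  · exact (norm_moebius_eq_one theta a h).le

theorem diffContOnCl_of_differentiableAt {f : ℂ → ℂ}
    (h : ∀ z : ℂ, ‖z‖ ≤ 1 → DifferentiableAt ℂ f z) : DiffContOnCl ℂ f (ball 0 1) := by
  refine DifferentiableOn.diffContOnCl fun z hz => ?_
  rw [closure_unitBall, mem_closedBall_zero_iff] at hz
  exact (h z hz).differentiableWithinAt

theorem diffContOnCl_moebius (theta : ℝ) (a : 𝔻) :
    DiffContOnCl ℂ (moebius theta a) (ball 0 1) := by
  refine diffContOnCl_of_differentiableAt fun z hz => ?_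
  have := moebius_denom_ne_zero a hz
  unfold moebius
  fun_prop (disch := assumption)

theorem DiffContOnCl.comp_moebius {f : ℂ → ℂ} (hf : DiffContOnCl ℂ f (ball 0 1)) (theta : ℝ)
    (a : 𝔻) : DiffContOnCl ℂ (fun z => f (moebius theta a z)) (ball 0 1) :=
  hf.comp (diffContOnCl_moebius theta a) fun z hz => by
    rw [mem_ball_zero_iff] at hz ⊢
    exact norm_moebius_lt_one theta a hz

/-- The centre of the inverse of the Moebius transformation `moebius theta a`. -/
noncomputable def moebiusInvCenter (theta : ℝ) (a : 𝔻) : 𝔻 :=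
  UnitDisc.mk (-(exp (theta * I) * a)) (by
    rw [norm_neg, norm_mul, norm_exp_ofReal_mul_I, one_mul]
    exact a.norm_lt_one)

theorem coe_moebiusInvCenter (theta : ℝ) (a : 𝔻) :
    (moebiusInvCenter theta a : ℂ) = -(exp (theta * I) * a) := rfl

theorem moebiusInvCenter_moebiusInvCenter (theta : ℝ) (a : 𝔻) :
    moebiusInvCenter (-theta) (moebiusInvCenter theta a) = a := by
  rw [← UnitDisc.coe_inj]
  rw [coe_moebiusInvCenter, coe_moebiusInvCenter, ofReal_neg, neg_mul, exp_neg]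
  field_simp [exp_ne_zero]

theorem moebius_inv_moebius (theta : ℝ) (a : 𝔻) {z : ℂ} (hz : ‖z‖ ≤ 1) :
    moebius (-theta) (moebiusInvCenter theta a) (moebius theta a z) = z := by
  have h1 := moebius_denom_ne_zero a hz
  have h2 := moebius_denom_ne_zero (moebiusInvCenter theta a) (norm_moebius_le_one theta a hz)
  have h3 := exp_mul_conj_exp theta
  have h4 : exp ((-theta : ℝ) * I) = conj (exp (theta * I)) := by
    rw [← exp_conj]
    simp
  have h5 : moebius theta a z * (1 - conj (a : ℂ) * z) = exp (theta * I) * (z - a) := by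
    rw [moebius, mul_assoc, div_mul_cancel₀ _ h1]
  rw [moebius, ← mul_div_assoc, div_eq_iff h2, h4, coe_moebiusInvCenter]
  simp only [map_neg, map_mul]
  refine mul_right_cancel₀ h1 ?_
  linear_combination (conj (exp (theta * I)) * (1 - z * conj (a : ℂ))) * h5 +
    (z - z * (conj (a : ℂ) * z)) * h3

theorem moebius_moebius_inv (theta : ℝ) (a : 𝔻) {z : ℂ} (hz : ‖z‖ ≤ 1) :
    moebius theta a (moebius (-theta) (moebiusInvCenter theta a) z) = z := by
  have := moebius_inv_moebius (-theta) (moebiusInvCenter theta a) hz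
  rwa [moebiusInvCenter_moebiusInvCenter, neg_neg] at this

/-- The Moebius transformation as a self-map of the unit disc. -/
noncomputable def moebiusDisc (theta : ℝ) (a z : 𝔻) : 𝔻 :=
  UnitDisc.mk (moebius theta a z) (norm_moebius_lt_one theta a z.norm_lt_one)

theorem coe_moebiusDisc (theta : ℝ) (a z : 𝔻) : (moebiusDisc theta a z : ℂ) = moebius theta a z :=
  rfl

theorem mul_cpow_of_re_pos {x y : ℂ} (hx : 0 < x.re) (hy : 0 < y.re) (s : ℂ) :
    (x * y) ^ s = x ^ s * y ^ s := by
  have hx0 : x ≠ 0 := fun h => by simp [h] at hx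
  have hy0 : y ≠ 0 := fun h => by simp [h] at hy
  have h1 := abs_lt.1 (abs_arg_lt_pi_div_two_iff.2 (Or.inl hx))
  have h2 := abs_lt.1 (abs_arg_lt_pi_div_two_iff.2 (Or.inl hy))
  rw [cpow_def_of_ne_zero (mul_ne_zero hx0 hy0), cpow_def_of_ne_zero hx0, cpow_def_of_ne_zero hy0,
    log_mul hx0 hy0 ⟨by linarith, by linarith⟩, add_mul, exp_add]

theorem conj_cpow_ofReal_of_re_pos {x : ℂ} (hx : 0 < x.re) (s : ℝ) :
    conj (x ^ (s : ℂ)) = conj x ^ (s : ℂ) := by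
  rw [conj_cpow x (s : ℂ) (slitPlane_arg_ne_pi (Or.inl hx)), conj_ofReal]

theorem re_one_sub_mul_conj_pos (z w : 𝔻) : 0 < (1 - (z : ℂ) * conj (w : ℂ)).re := by
  have := (re_le_norm _).trans_lt (norm_coe_mul_conj_lt_one z w)
  simpa using this

theorem inv_re_pos {x : ℂ} (hx : 0 < x.re) : 0 < x⁻¹.re := by
  have hx0 : x ≠ 0 := fun h => by simp [h] at hx
  rw [inv_re]
  exact div_pos hx (normSq_pos.2 hx0)

theorem kerVal_moebius (lam : ℝ≥0) (theta : ℝ) (a z w : 𝔻) :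
    kerVal lam (moebius theta a z) (moebius theta a w) =
      (((1 - ‖(a : ℂ)‖ ^ 2) ^ (lam : ℝ) : ℝ) : ℂ)⁻¹ *
        ((1 - conj (a : ℂ) * z) ^ ((lam : ℝ) : ℂ) *
          conj ((1 - conj (a : ℂ) * w) ^ ((lam : ℝ) : ℂ))) * kerVal lam z w := by
  have h := one_sub_moebius_mul_conj theta a z.norm_lt_one.le w.norm_lt_one.le
  have hW := re_one_sub_mul_conj_pos (moebiusDisc theta a z) (moebiusDisc theta a w)
  rw [coe_moebiusDisc, coe_moebiusDisc] at hW
  have hp := re_moebius_denom_pos a z.norm_lt_one.le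
  have hq := re_moebius_denom_pos a w.norm_lt_one.le
  have hu := re_one_sub_mul_conj_pos z w
  have ht : 0 < 1 - ‖(a : ℂ)‖ ^ 2 := sub_pos.2 a.sq_norm_lt_one
  rw [conj_cpow_ofReal_of_re_pos hq, ofReal_cpow ht.le]
  simp only [kerVal]
  have hq' : 0 < (conj (1 - conj (a : ℂ) * w)).re := by rwa [conj_re]
  set W := 1 - moebius theta a z * conj (moebius theta a w)
  set p := 1 - conj (a : ℂ) * z
  set q := conj (1 - conj (a : ℂ) * w)
  set u := 1 - (z : ℂ) * conj (w : ℂ)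
  set t := 1 - ‖(a : ℂ)‖ ^ 2
  have hne : ∀ {x : ℂ}, 0 < x.re → x ^ ((lam : ℝ) : ℂ) ≠ 0 := fun {x} hx h0 => by
    have := (cpow_eq_zero_iff _ _).1 h0
    simp [this.1] at hx
  have hq0 : q ≠ 0 := fun h => by simp [h] at hq'
  have ht' : 0 < ((t : ℝ) : ℂ).re := by simpa using ht
  have htu : 0 < ((t : ℂ) * u).re := by rw [re_ofReal_mul]; exact mul_pos ht hu
  have key : W * p = (t * u) * q⁻¹ := by
    rw [← h, mul_inv_cancel_right₀ hq0]
  have key2 : W ^ ((lam : ℝ) : ℂ) * p ^ ((lam : ℝ) : ℂ) =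
      (t : ℂ) ^ ((lam : ℝ) : ℂ) * u ^ ((lam : ℝ) : ℂ) * (q ^ ((lam : ℝ) : ℂ))⁻¹ := by
    rw [← mul_cpow_of_re_pos hW hp, key, mul_cpow_of_re_pos htu (inv_re_pos hq'),
      mul_cpow_of_re_pos ht' hu, inv_cpow _ _ (slitPlane_arg_ne_pi (Or.inl hq'))]
  have h1 := hne hW
  have h2 := hne hp
  have h3 := hne hq'
  have h4 := hne hu
  have h5 := hne ht'
  field_simp at key2 ⊢
  linear_combination -key2

theorem exists_compOp {lam : ℝ≥0} (hlam : 1 ≤ lam) (theta : ℝ) (a : 𝔻) :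
    ∃ A : DiscSpace lam →L[ℂ] DiscSpace lam, ∀ f z, A f z = f (moebiusDisc theta a z) := by
  have ht : 0 < 1 - ‖(a : ℂ)‖ ^ 2 := sub_pos.2 a.sq_norm_lt_one
  set P : ℂ → ℂ := fun z => (1 - conj (a : ℂ) * z) ^ ((lam : ℝ) : ℂ) with hP
  have hP0 : ∀ z : 𝔻, P z ≠ 0 := fun z h0 =>
    moebius_denom_ne_zero a z.norm_lt_one.le ((cpow_eq_zero_iff _ _).1 h0).1
  have hPd : DiffContOnCl ℂ P (ball 0 1) := by
    refine diffContOnCl_of_differentiableAt fun z hz => ?_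
    exact DifferentiableAt.cpow_const (by fun_prop) (Or.inl (re_moebius_denom_pos a hz))
  obtain ⟨A, -, hA⟩ := exists_weighted_comp (lam := lam) (mu := lam) (moebiusDisc theta a)
    (fun z => (P z)⁻¹) (C := √((1 - ‖(a : ℂ)‖ ^ 2) ^ (lam : ℝ))⁻¹) (Real.sqrt_nonneg _) (by
      intro s v
      refine le_of_eq ?_
      rw [eq_comm, Finset.sum_eq_zero, zero_re]
      intro x _
      refine Finset.sum_eq_zero fun y _ => ?_
      have h1 := hP0 x
      have h2 : conj (P y) ≠ 0 := (map_ne_zero _).2 (hP0 y)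
      beta_reduce
      rw [coe_moebiusDisc, coe_moebiusDisc, kerVal_moebius, ← ofReal_pow,
        Real.sq_sqrt (by positivity), ofReal_inv, map_inv₀]
      change _ * (_ - _ * (_ * (P x * conj (P y)) * _)) = 0
      field_simp
      ring)
  refine ⟨mulOp lam lam P ∘L A, fun f z => ?_⟩
  rw [ContinuousLinearMap.comp_apply, mulOp_apply' hlam le_rfl hPd, hA, mul_inv_cancel_left₀ (hP0 z)]

/-! ### Power series, intertwiners and commutators -/

/-- Multiplication by the coordinate function on `H^(lam)`. -/
noncomputable abbrev mulZ (lam : ℝ≥0) : DiscSpace lam →L[ℂ] DiscSpace lam :=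
  mulOp lam lam fun z => z

theorem mulZ_apply {lam : ℝ≥0} (hlam : 1 ≤ lam) (f : DiscSpace lam) (z : 𝔻) :
    mulZ lam f z = z * f z :=
  mulOp_apply' hlam le_rfl diffContOnCl_id' f z

theorem mulZ_pow_apply {lam : ℝ≥0} (hlam : 1 ≤ lam) (n : ℕ) (f : DiscSpace lam) (z : 𝔻) :
    (mulZ lam ^ n) f z = z ^ n * f z := by
  induction n with
  | zero => simp
  | succ n ih =>
    rw [pow_succ', mul_apply_eq_comp, mulZ_apply hlam, ih]
    ring

theorem norm_mulZ_le {lam : ℝ≥0} (hlam : 1 ≤ lam) : ‖mulZ lam‖ ≤ 1 :=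
  norm_mulOp_le hlam le_rfl diffContOnCl_id' fun _ hz => hz.le

theorem norm_mulZ_pow_apply_le {lam : ℝ≥0} (hlam : 1 ≤ lam) (n : ℕ) (f : DiscSpace lam) :
    ‖(mulZ lam ^ n) f‖ ≤ ‖f‖ := by
  induction n with
  | zero => simp
  | succ n ih =>
    rw [pow_succ', mul_apply_eq_comp]
    refine ((mulZ lam).le_of_opNorm_le (norm_mulZ_le hlam) _).trans ?_
    rwa [one_mul]

/-- The constant function `1`. -/
noncomputable def oneFn (lam : ℝ≥0) : DiscSpace lam := kern lam 0

theorem oneFn_apply (lam : ℝ≥0) (z : 𝔻) : oneFn lam z = 1 := by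
  simp [oneFn, kern_apply, kerVal]

theorem summable_choose_mul_pow (lam : ℝ≥0) {r : ℝ} (hr0 : 0 ≤ r) (hr : r < 1) :
    Summable fun n : ℕ => Ring.choose ((lam : ℝ) + n - 1) n * r ^ n := by
  have h := (hasSum_discKernel lam (x := (r : ℂ)) (by
    rwa [norm_real, Real.norm_of_nonneg hr0])).summable
  have := (Complex.hasSum_iff _ _).1 h.hasSum |>.1.summable
  convert this using 2 with n
  rw [← ofReal_pow, ← ofReal_mul, ofReal_re]

theorem eval_continuous {lam : ℝ≥0} (z : 𝔻) :
    ∃ e : DiscSpace lam →L[ℂ] ℂ, ∀ f, e f = f z :=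
  ⟨innerSL ℂ (kern lam z), fun f => inner_kern f z⟩

/-- The expansion of the kernel functions into powers of the coordinate function. -/
theorem hasSum_kern {lam : ℝ≥0} (hlam : 1 ≤ lam) (w : 𝔻) :
    HasSum (fun n : ℕ => (((Ring.choose ((lam : ℝ) + n - 1) n : ℝ) : ℂ) * conj (w : ℂ) ^ n) •
      (mulZ lam ^ n) (oneFn lam)) (kern lam w) := by
  have hs : Summable fun n : ℕ => (((Ring.choose ((lam : ℝ) + n - 1) n : ℝ) : ℂ) *
      conj (w : ℂ) ^ n) • (mulZ lam ^ n) (oneFn lam) := by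
    refine Summable.of_norm_bounded ((summable_choose_mul_pow lam (norm_nonneg (w : ℂ))
      w.norm_lt_one).mul_right ‖oneFn lam‖) fun n => ?_
    rw [norm_smul, norm_mul, norm_pow, RCLike.norm_conj, norm_real,
      Real.norm_of_nonneg (choose_nonneg lam n)]
    exact mul_le_mul_of_nonneg_left (norm_mulZ_pow_apply_le hlam n _)
      (mul_nonneg (choose_nonneg lam n) (by positivity))
  convert hs.hasSum
  ext z
  obtain ⟨e, he⟩ := eval_continuous (lam := lam) z
  have h1 := e.hasSum hs.hasSum
  have h2 := hasSum_discKernel lam (norm_coe_mul_conj_lt_one z w)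
  rw [← he (tsum _), kern_apply]
  refine h2.unique ?_
  convert h1 using 2 with n
  rw [map_smul, he, mulZ_pow_apply hlam, oneFn_apply, smul_eq_mul, mul_pow]
  ring

theorem exists_differentiableOn {lam : ℝ≥0} (hlam : 1 ≤ lam) (f : DiscSpace lam) :
    ∃ F : ℂ → ℂ, DifferentiableOn ℂ F (ball 0 1) ∧ ∀ z : 𝔻, F z = f z := by
  set c : ℕ → ℂ := fun n => ((Ring.choose ((lam : ℝ) + n - 1) n : ℝ) : ℂ) *
    ⟪(mulZ lam ^ n) (oneFn lam), f⟫_ℂ with hc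
  refine ⟨fun z => ∑' n, c n * z ^ n, ?_, fun z => ?_⟩
  · intro z hz
    rw [mem_ball_zero_iff] at hz
    obtain ⟨r, hzr, hr⟩ := exists_between hz
    have hr0 : 0 ≤ r := (norm_nonneg z).trans hzr.le
    have h := differentiableOn_tsum_of_summable_norm (U := ball (0 : ℂ) r)
      (F := fun n z => c n * z ^ n)
      ((summable_choose_mul_pow lam hr0 hr).mul_right (‖oneFn lam‖ * ‖f‖))
      (fun n => by fun_prop) isOpen_ball (fun n w hw => by
        rw [mem_ball_zero_iff] at hw
        rw [hc, norm_mul, norm_mul, norm_pow, norm_real, Real.norm_of_nonneg (choose_nonneg lam n),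
          mul_right_comm]
        refine mul_le_mul (mul_le_mul_of_nonneg_left ?_ (choose_nonneg lam n))
          ((norm_inner_le_norm _ _).trans ?_) (norm_nonneg _) ?_
        · exact pow_le_pow_left₀ (norm_nonneg w) hw.le n
        · exact mul_le_mul_of_nonneg_right (norm_mulZ_pow_apply_le hlam n _) (norm_nonneg _)
        · exact mul_nonneg (choose_nonneg lam n) (by positivity))
    exact (h.differentiableAt (isOpen_ball.mem_nhds (mem_ball_zero_iff.2 hzr))
      ).differentiableWithinAt
  · have h := ((innerSL ℂ f).hasSum (hasSum_kern hlam z)).map (starRingEnd ℂ) continuous_conj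
    rw [innerSL_apply_apply, inner_conj_symm, inner_kern] at h
    rw [← h.tsum_eq]
    refine tsum_congr fun n => ?_
    simp only [hc, Function.comp_apply, innerSL_apply_apply, inner_smul_right, map_mul, map_pow,
      conj_conj, conj_ofReal, inner_conj_symm]
    ring

theorem apply_eq_mul_of_commute {lam mu : ℝ≥0} (hlam : 1 ≤ lam) (hmu : 1 ≤ mu)
    {B : DiscSpace lam →L[ℂ] DiscSpace mu} (hB : ∀ f, B (mulZ lam f) = mulZ mu (B f))
    (f : DiscSpace lam) (z : 𝔻) : B f z = B (oneFn lam) z * f z := by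
  have hpow : ∀ n : ℕ, B ((mulZ lam ^ n) (oneFn lam)) = (mulZ mu ^ n) (B (oneFn lam)) := by
    intro n
    induction n with
    | zero => simp
    | succ n ih =>
      rw [pow_succ', pow_succ', mul_apply_eq_comp, hB, ih,
        mul_apply_eq_comp]
  obtain ⟨e, he⟩ := eval_continuous (lam := lam) z
  obtain ⟨e', he'⟩ := eval_continuous (lam := mu) z
  have : e' ∘L B = B (oneFn lam) z • e := by
    refine clm_ext_kern fun w => ?_
    have h1 := (e' ∘L B).hasSum (hasSum_kern hlam w)
    refine h1.unique ?_
    convert ((B (oneFn lam) z) • e).hasSum (hasSum_kern hlam w) using 2 with n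
    simp only [map_smul, ContinuousLinearMap.comp_apply, smul_apply, hpow, he,
      he', mulZ_pow_apply hlam, mulZ_pow_apply hmu, oneFn_apply, smul_eq_mul]
    ring
  have h := congrArg (fun A : DiscSpace lam →L[ℂ] ℂ => A f) this
  simpa [he, he'] using h

theorem kerVal_self (lam : ℝ≥0) (u : 𝔻) :
    kerVal lam u u = (((1 - ‖(u : ℂ)‖ ^ 2) ^ (-(lam : ℝ)) : ℝ) : ℂ) := by
  have ht : 0 < 1 - ‖(u : ℂ)‖ ^ 2 := sub_pos.2 u.sq_norm_lt_one
  rw [kerVal, mul_conj, normSq_eq_norm_sq, Real.rpow_neg ht.le, ofReal_inv, ofReal_cpow ht.le,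
    one_div]
  push_cast
  rfl

theorem norm_kern_sq (lam : ℝ≥0) (u : 𝔻) :
    ‖kern lam u‖ ^ 2 = (1 - ‖(u : ℂ)‖ ^ 2) ^ (-(lam : ℝ)) := by
  rw [← inner_self_eq_norm_sq (𝕜 := ℂ), inner_kern_kern, kerVal_self]
  exact ofReal_re _

theorem norm_kern (lam : ℝ≥0) (u : 𝔻) :
    ‖kern lam u‖ = (1 - ‖(u : ℂ)‖ ^ 2) ^ (-(lam : ℝ) / 2) := by
  have ht : 0 < 1 - ‖(u : ℂ)‖ ^ 2 := sub_pos.2 u.sq_norm_lt_one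
  rw [← Real.sqrt_sq (norm_nonneg (kern lam u)), norm_kern_sq, Real.sqrt_eq_rpow,
    ← Real.rpow_mul ht.le]
  ring_nf

theorem norm_apply_le_norm_kern {lam : ℝ≥0} (f : DiscSpace lam) (z : 𝔻) :
    ‖f z‖ ≤ ‖kern lam z‖ * ‖f‖ := by
  rw [← inner_kern]
  exact norm_inner_le_norm _ _

theorem eq_zero_of_norm_le_rpow {F : ℂ → ℂ} (hF : DifferentiableOn ℂ F (ball 0 1)) {C ε : ℝ}
    (hε : 0 < ε) (h : ∀ z : ℂ, ‖z‖ < 1 → ‖F z‖ ≤ C * (1 - ‖z‖ ^ 2) ^ ε) {z : ℂ} (hz : ‖z‖ < 1) :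
    F z = 0 := by
  have h1 : ∀ r : ℝ, ‖z‖ < r → r < 1 → ‖F z‖ ≤ C * (1 - r ^ 2) ^ ε := by
    intro r hzr hr
    have hr0 : 0 < r := (norm_nonneg z).trans_lt hzr
    refine Complex.norm_le_of_forall_mem_frontier_norm_le (U := ball (0 : ℂ) r) isBounded_ball
      (hF.mono ?_).diffContOnCl (fun w hw => ?_) (subset_closure (mem_ball_zero_iff.2 hzr))
    · rw [closure_ball _ hr0.ne']
      exact closedBall_subset_ball hr
    · rw [frontier_ball _ hr0.ne', mem_sphere_zero_iff_norm] at hw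
      have := h w (hw ▸ hr)
      rwa [hw] at this
  have h2 : Filter.Tendsto (fun r : ℝ => C * (1 - r ^ 2) ^ ε) (nhdsWithin 1 (Set.Iio 1))
      (nhds 0) := by
    have : ContinuousAt (fun r : ℝ => C * (1 - r ^ 2) ^ ε) 1 :=
      continuousAt_const.mul (ContinuousAt.rpow_const (by fun_prop) (Or.inr hε.le))
    have h3 := this.tendsto.mono_left (nhdsWithin_le_nhds (s := Set.Iio 1))
    simpa [Real.zero_rpow hε.ne'] using h3
  rw [← norm_le_zero_iff]
  refine ge_of_tendsto h2 ?_
  filter_upwards [Ioo_mem_nhdsLT hz] with r hr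
  exact h1 r hr.1 hr.2

theorem le_rpow_of_mul_le {t G N l m : ℝ} (ht : 0 < t)
    (h : G * (t⁻¹ * t ^ (-l)) ≤ t ^ (-m / 2) * (N * t ^ (-l / 2))) :
    G ≤ N * t ^ (1 + (l - m) / 2) := by
  have h1 : t * t ^ l = t ^ (1 + l) := by rw [Real.rpow_add ht, Real.rpow_one]
  have h2 : t⁻¹ * t ^ (-l) = t ^ (-(1 + l)) := by
    rw [Real.rpow_neg ht.le, Real.rpow_neg ht.le, ← h1, mul_inv]
  have h3 : t ^ (-(1 + l)) * t ^ (1 + l) = 1 := by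
    rw [← Real.rpow_add ht, neg_add_cancel, Real.rpow_zero]
  have h4 : t ^ (1 + (l - m) / 2) = t ^ (-m / 2) * t ^ (-l / 2) * t ^ (1 + l) := by
    rw [← Real.rpow_add ht, ← Real.rpow_add ht]
    congr 1
    ring
  have h5 : 0 ≤ t ^ (1 + l) := Real.rpow_nonneg ht.le _
  rw [h2] at h
  have h6 := mul_le_mul_of_nonneg_right h h5
  rw [mul_assoc, h3, mul_one] at h6
  rw [h4]
  linarith

theorem norm_apply_le_of_commutator {lam mu : ℝ≥0} (hlam : 1 ≤ lam)
    (P : DiscSpace lam →L[ℂ] DiscSpace mu) {g : DiscSpace mu}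
    (h : ∀ f, ∀ z : 𝔻, P (mulZ lam f) z - z * P f z = g z * f z) (u : 𝔻) :
    ‖g u‖ ≤ ‖P‖ * (1 - ‖(u : ℂ)‖ ^ 2) ^ (1 + ((lam : ℝ) - mu) / 2) := by
  have ht : 0 < 1 - ‖(u : ℂ)‖ ^ 2 := sub_pos.2 u.sq_norm_lt_one
  refine le_rpow_of_mul_le ht ?_
  obtain ⟨f, hf⟩ : ∃ f : DiscSpace lam, ∀ z : 𝔻,
      f z = (1 - (z : ℂ) * conj (u : ℂ))⁻¹ * kern lam u z :=
    ⟨_, mulOp_apply' hlam le_rfl (diffContOnCl_szego u) _⟩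
  obtain ⟨f', hf', h3⟩ : ∃ f' : DiscSpace lam, (∀ z : 𝔻, f' z = moebius 0 u z * kern lam u z) ∧
      ‖f'‖ ≤ ‖kern lam u‖ := by
    refine ⟨_, mulOp_apply' hlam le_rfl (diffContOnCl_moebius 0 u) _, ?_⟩
    have := norm_mulOp_le hlam le_rfl (diffContOnCl_moebius 0 u)
      fun z hz => (norm_moebius_eq_one 0 u hz).le
    simpa using (mulOp lam lam (moebius 0 u)).le_of_opNorm_le this (kern lam u)
  have hff : mulZ lam f - (u : ℂ) • f = f' := by
    ext z
    simp only [RKHS.coe_sub, RKHS.coe_smul, Pi.sub_apply, Pi.smul_apply, mulZ_apply hlam, hf, hf',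
      moebius, smul_eq_mul, ofReal_zero, zero_mul, exp_zero]
    rw [mul_comm (conj (u : ℂ)), div_eq_mul_inv]
    ring
  have h2 : P f' u = g u * f u := by
    rw [← h f u, ← hff, map_sub, map_smul, RKHS.coe_sub, RKHS.coe_smul, Pi.sub_apply,
      Pi.smul_apply, smul_eq_mul]
  have h4 : ‖f u‖ = (1 - ‖(u : ℂ)‖ ^ 2)⁻¹ * (1 - ‖(u : ℂ)‖ ^ 2) ^ (-(lam : ℝ)) := by
    rw [hf, kern_apply, kerVal_self, norm_mul, norm_inv, mul_conj, normSq_eq_norm_sq,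
      ← ofReal_one, ← ofReal_sub, norm_real, norm_real, Real.norm_of_nonneg ht.le,
      Real.norm_of_nonneg (Real.rpow_nonneg ht.le _)]
  rw [← h4, ← norm_mul, ← h2, ← norm_kern, ← norm_kern]
  refine (norm_apply_le_norm_kern _ _).trans (mul_le_mul_of_nonneg_left ?_ (norm_nonneg _))
  exact (P.le_opNorm _).trans (mul_le_mul_of_nonneg_left h3 (norm_nonneg _))

/-- A multiplication operator which is a commutator with the multiplication by the coordinate
function vanishes. -/
theorem eq_zero_of_commutator {lam mu : ℝ≥0} (hlam : 1 ≤ lam) (hmu : 1 ≤ mu) (hmu2 : mu < lam + 2)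
    (P : DiscSpace lam →L[ℂ] DiscSpace mu) {g : DiscSpace mu}
    (h : ∀ f, ∀ z : 𝔻, P (mulZ lam f) z - z * P f z = g z * f z) : g = 0 := by
  obtain ⟨G, hG, hGg⟩ := exists_differentiableOn hmu g
  ext z
  rw [← hGg, RKHS.coe_zero, Pi.zero_apply]
  have hmu2' : (mu : ℝ) < lam + 2 := by exact_mod_cast hmu2
  refine eq_zero_of_norm_le_rpow hG (C := ‖P‖) (ε := 1 + ((lam : ℝ) - mu) / 2) (by linarith)
    (fun w hw => ?_) z.norm_lt_one
  have := norm_apply_le_of_commutator hlam P h (UnitDisc.mk w hw)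
  rwa [← hGg] at this

/-! ### Operator matrices -/

theorem isUnit_one_sub_smul {R : Type*} [Ring R] [Algebra ℂ R] {T : R}
    (h : ∀ z : ℂ, 1 < ‖z‖ → IsUnit (z • 1 - T)) {b : ℂ} (hb : ‖b‖ < 1) : IsUnit (1 - b • T) := by
  rcases eq_or_ne b 0 with rfl | h0
  · simp
  · have h1 : 1 < ‖b⁻¹‖ := by
      rw [norm_inv]
      exact (one_lt_inv₀ (norm_pos_iff.2 h0)).2 hb
    have h2 : 1 - b • T = b • (b⁻¹ • 1 - T) := by
      rw [smul_sub, smul_smul, mul_inv_cancel₀ h0, one_smul]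
    rw [h2]
    exact (h _ h1).smul (Units.mk0 b h0)

theorem star_mul_one_sub_smul {R : Type*} [Ring R] [StarRing R] [Algebra ℂ R] [StarModule ℂ R]
    {X S : R} {b c e : ℂ} (h : X * (1 - b • S) = e • (S - c • 1)) :
    (1 - conj b • star S) * star X = conj e • (star S - conj c • 1) := by
  have := congrArg star h
  simpa only [star_mul, star_sub, star_one, star_smul, RCLike.star_def] using this

section OperatorMatrices

variable {E F : Type*} [NormedAddCommGroup E] [InnerProductSpace ℂ E]
  [NormedAddCommGroup F] [InnerProductSpace ℂ F]

theorem clm_prod_ext {X Y : WithLp 2 (E × F) →L[ℂ] WithLp 2 (E × F)}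
    (h : ∀ x y, X (WithLp.toLp 2 (x, y)) = Y (WithLp.toLp 2 (x, y))) : X = Y := by
  ext1 p
  exact h p.fst p.snd

theorem blockOp_mul (A A' : E →L[ℂ] E) (B B' : F →L[ℂ] E) (C C' : E →L[ℂ] F) (D D' : F →L[ℂ] F) :
    blockOp A B C D * blockOp A' B' C' D' =
      blockOp (A ∘L A' + B ∘L C') (A ∘L B' + B ∘L D') (C ∘L A' + D ∘L C')
        (C ∘L B' + D ∘L D') := by
  refine clm_prod_ext fun x y => ?_
  rw [mul_apply_eq_comp, blockOp_apply, blockOp_apply, blockOp_apply]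
  simp only [map_add, add_apply, ContinuousLinearMap.comp_apply]
  congr 2 <;> abel

theorem smul_one_sub_blockOp (z : ℂ) (A : E →L[ℂ] E) (B : F →L[ℂ] E) (C : E →L[ℂ] F)
    (D : F →L[ℂ] F) :
    z • 1 - blockOp A B C D = blockOp (z • 1 - A) (-B) (-C) (z • 1 - D) := by
  refine clm_prod_ext fun x y => ?_
  simp only [sub_apply, smul_apply, one_apply_eq_self, blockOp_apply, neg_apply]
  rw [← WithLp.toLp_smul, ← WithLp.toLp_sub]
  simp only [Prod.smul_mk, Prod.mk_sub_mk]
  congr 2 <;> abel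

theorem exists_eq_blockOp (Y : WithLp 2 (E × F) →L[ℂ] WithLp 2 (E × F)) :
    ∃ A B C D, Y = blockOp A B C D := by
  let e := WithLp.prodContinuousLinearEquiv 2 ℂ E F
  let Z := e.toContinuousLinearMap ∘L Y ∘L e.symm.toContinuousLinearMap
  refine ⟨ContinuousLinearMap.fst ℂ E F ∘L Z ∘L ContinuousLinearMap.inl ℂ E F,
    ContinuousLinearMap.fst ℂ E F ∘L Z ∘L ContinuousLinearMap.inr ℂ E F,
    ContinuousLinearMap.snd ℂ E F ∘L Z ∘L ContinuousLinearMap.inl ℂ E F,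
    ContinuousLinearMap.snd ℂ E F ∘L Z ∘L ContinuousLinearMap.inr ℂ E F, ?_⟩
  refine clm_prod_ext fun x y => ?_
  rw [blockOp_apply]
  have h : ∀ x y, Y (WithLp.toLp 2 (x, y)) = e.symm (Z (x, y)) := fun x y => by
    simp [Z, e]
  have h1 : ((x, y) : E × F) = (x, 0) + (0, y) := by simp
  rw [h, h1, map_add]
  rfl

theorem blockOp_inj {A A' : E →L[ℂ] E} {B B' : F →L[ℂ] E} {C C' : E →L[ℂ] F} {D D' : F →L[ℂ] F}
    (h : blockOp A B C D = blockOp A' B' C' D') : A = A' ∧ B = B' ∧ C = C' ∧ D = D' := by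
  have h1 : ∀ x y, A x + B y = A' x + B' y ∧ C x + D y = C' x + D' y := fun x y => by
    have := congrArg (fun X => WithLp.ofLp (X (WithLp.toLp 2 (x, y)))) h
    simpa only [blockOp_apply, Prod.mk.injEq] using this
  refine ⟨?_, ?_, ?_, ?_⟩ <;> ext x
  · simpa using (h1 x 0).1
  · simpa using (h1 0 x).1
  · simpa using (h1 x 0).2
  · simpa using (h1 0 x).2

theorem isUnit_blockOp_upper {A : E →L[ℂ] E} {D : F →L[ℂ] F} (hA : IsUnit A) (hD : IsUnit D)
    (B : F →L[ℂ] E) : IsUnit (blockOp A B 0 D) := by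
  obtain ⟨A, rfl⟩ := hA
  obtain ⟨D, rfl⟩ := hD
  have hA1 : ∀ x, (A : E →L[ℂ] E) ((↑A⁻¹ : E →L[ℂ] E) x) = x := fun x => by
    rw [← mul_apply_eq_comp, A.mul_inv, one_apply_eq_self]
  have hA2 : ∀ x, (↑A⁻¹ : E →L[ℂ] E) ((A : E →L[ℂ] E) x) = x := fun x => by
    rw [← mul_apply_eq_comp, A.inv_mul, one_apply_eq_self]
  have hD1 : ∀ x, (D : F →L[ℂ] F) ((↑D⁻¹ : F →L[ℂ] F) x) = x := fun x => by
    rw [← mul_apply_eq_comp, D.mul_inv, one_apply_eq_self]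
  have hD2 : ∀ x, (↑D⁻¹ : F →L[ℂ] F) ((D : F →L[ℂ] F) x) = x := fun x => by
    rw [← mul_apply_eq_comp, D.inv_mul, one_apply_eq_self]
  refine ⟨⟨blockOp A B 0 D, blockOp (↑A⁻¹ : E →L[ℂ] E)
    (-((↑A⁻¹ : E →L[ℂ] E) ∘L B ∘L (↑D⁻¹ : F →L[ℂ] F))) 0 (↑D⁻¹ : F →L[ℂ] F), ?_, ?_⟩, rfl⟩ <;>
  · refine clm_prod_ext fun x y => ?_
    rw [mul_apply_eq_comp, blockOp_apply, blockOp_apply]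
    simp [hA1, hA2, hD1, hD2]

theorem isUnit_blockOp_diag {A : E →L[ℂ] E} {D : F →L[ℂ] F} (hA : IsUnit A) (hD : IsUnit D) :
    IsUnit (blockOp A 0 0 D) :=
  isUnit_blockOp_upper hA hD 0

theorem surjective_of_isUnit_blockOp_lower {A : E →L[ℂ] E} {C : E →L[ℂ] F} {D : F →L[ℂ] F}
    (h : IsUnit (blockOp A 0 C D)) : Function.Surjective A := by
  obtain ⟨u, hu⟩ := h
  intro x
  obtain ⟨p, hp⟩ : ∃ p, blockOp A 0 C D p = WithLp.toLp 2 (x, 0) :=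
    ⟨(↑u⁻¹ : WithLp 2 (E × F) →L[ℂ] WithLp 2 (E × F)) (WithLp.toLp 2 (x, 0)), by
      rw [← hu, ← mul_apply_eq_comp, u.mul_inv, one_apply_eq_self]⟩
  have h2 : A p.fst + (0 : F →L[ℂ] E) p.snd = x := congrArg (fun p => p.fst) hp
  exact ⟨p.fst, by simpa using h2⟩

variable [CompleteSpace E] [CompleteSpace F]

theorem star_blockOp (A : E →L[ℂ] E) (B : F →L[ℂ] E) (C : E →L[ℂ] F) (D : F →L[ℂ] F) :
    star (blockOp A B C D) = blockOp (ContinuousLinearMap.adjoint A)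
      (ContinuousLinearMap.adjoint C) (ContinuousLinearMap.adjoint B)
      (ContinuousLinearMap.adjoint D) := by
  rw [ContinuousLinearMap.star_eq_adjoint, eq_comm, ContinuousLinearMap.eq_adjoint_iff]
  intro p q
  obtain ⟨x, y, rfl⟩ : ∃ x y, p = WithLp.toLp 2 (x, y) := ⟨p.fst, p.snd, rfl⟩
  obtain ⟨x', y', rfl⟩ : ∃ x y, q = WithLp.toLp 2 (x, y) := ⟨q.fst, q.snd, rfl⟩
  simp only [blockOp_apply, WithLp.prod_inner_apply, inner_add_left, inner_add_right,
    ContinuousLinearMap.adjoint_inner_left]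
  abel

theorem isUnit_smul_one_sub_of_norm_lt {A : E →L[ℂ] E} {z : ℂ} (hz : ‖A‖ < ‖z‖) :
    IsUnit (z • 1 - A) := by
  rw [← Algebra.algebraMap_eq_smul_one, ← spectrum.notMem_iff]
  intro h
  have h1 := spectrum.norm_le_norm_mul_of_mem h
  have h2 : ‖A‖ * ‖(1 : E →L[ℂ] E)‖ ≤ ‖A‖ :=
    mul_le_of_le_one_right (norm_nonneg _) ContinuousLinearMap.norm_id_le
  linarith

theorem isUnit_smul_one_sub_blockOp {A : E →L[ℂ] E} {D : F →L[ℂ] F} (hA : ‖A‖ ≤ 1)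
    (hD : ‖D‖ ≤ 1) (B : F →L[ℂ] E) {z : ℂ} (hz : 1 < ‖z‖) :
    IsUnit (z • 1 - blockOp A B 0 D) := by
  rw [smul_one_sub_blockOp, neg_zero]
  exact isUnit_blockOp_upper (isUnit_smul_one_sub_of_norm_lt (hA.trans_lt hz))
    (isUnit_smul_one_sub_of_norm_lt (hD.trans_lt hz)) _

theorem spectrum_blockOp_subset {A : E →L[ℂ] E} {D : F →L[ℂ] F} (hA : ‖A‖ ≤ 1)
    (hD : ‖D‖ ≤ 1) (B : F →L[ℂ] E) : spectrum ℂ (blockOp A B 0 D) ⊆ closedBall 0 1 := by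
  intro z hz
  rw [mem_closedBall_zero_iff]
  by_contra! h
  refine hz ?_
  rw [spectrum.mem_resolventSet_iff, Algebra.algebraMap_eq_smul_one]
  exact isUnit_smul_one_sub_blockOp hA hD B h

theorem isUnit_one_sub_smul_blockOp {A : E →L[ℂ] E} {D : F →L[ℂ] F} (hA : ‖A‖ ≤ 1)
    (hD : ‖D‖ ≤ 1) (B : F →L[ℂ] E) {b : ℂ} (hb : ‖b‖ < 1) :
    IsUnit (1 - b • blockOp A B 0 D) :=
  isUnit_one_sub_smul (fun _ hz => isUnit_smul_one_sub_blockOp hA hD B hz) hb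

theorem isSimilar_star_iff {S T : E →L[ℂ] E} :
    IsSimilar (star S) (star T) ↔ ∃ Y : E →L[ℂ] E, IsUnit Y ∧ S * Y = Y * T := by
  constructor
  · rintro ⟨L, hL⟩
    set u := (ContinuousLinearEquiv.unitsEquiv ℂ E).symm L
    have h1 : (u : E →L[ℂ] E) * star S * (↑u⁻¹ : E →L[ℂ] E) = star T := by
      rw [← hL]; rfl
    have h2 : (u : E →L[ℂ] E) * star S = star T * u := by
      rw [← h1, mul_assoc, u.inv_mul, mul_one]
    refine ⟨star (u : E →L[ℂ] E), u.isUnit.star, ?_⟩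
    have := congrArg star h2
    simpa only [star_mul, star_star] using this
  · rintro ⟨_, ⟨u, rfl⟩, h⟩
    refine ⟨ContinuousLinearEquiv.unitsEquiv ℂ E (star u), ?_⟩
    have h1 : star (u : E →L[ℂ] E) * star S = star T * star (u : E →L[ℂ] E) := by
      rw [← star_mul, h, star_mul]
    have h2 : ((star u : (E →L[ℂ] E)ˣ) : E →L[ℂ] E) * star S *
        (↑(star u)⁻¹ : E →L[ℂ] E) = star T := by
      rw [Units.coe_star, h1, mul_assoc, ← Units.coe_star, Units.mul_inv, mul_one]
    rw [← h2]
    rfl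

end OperatorMatrices

/-! ### The lower triangular operators -/

/-- The operator `(f, g) ↦ (z f, q f + z g)` on `H^(lam) ⊕ H^(mu)`. -/
noncomputable def lowerOp (lam mu : ℝ≥0) (q : ℂ → ℂ) :
    WithLp 2 (DiscSpace lam × DiscSpace mu) →L[ℂ] WithLp 2 (DiscSpace lam × DiscSpace mu) :=
  blockOp (mulZ lam) 0 (mulOp lam mu q) (mulZ mu)

/-- The derivative of `moebius theta a`. -/
noncomputable def moebiusDeriv (theta : ℝ) (a : 𝔻) (z : ℂ) : ℂ :=
  exp (theta * I) * (1 - conj (a : ℂ) * a) * ((1 - conj (a : ℂ) * z)⁻¹) ^ 2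

theorem moebiusDeriv_ne_zero (theta : ℝ) (a : 𝔻) {z : ℂ} (hz : ‖z‖ ≤ 1) :
    moebiusDeriv theta a z ≠ 0 :=
  mul_ne_zero (mul_ne_zero (exp_ne_zero _) (moebius_denom_ne_zero a a.norm_lt_one.le))
    (pow_ne_zero _ (inv_ne_zero (moebius_denom_ne_zero a hz)))

theorem diffContOnCl_moebiusDeriv (theta : ℝ) (a : 𝔻) :
    DiffContOnCl ℂ (moebiusDeriv theta a) (ball 0 1) := by
  refine diffContOnCl_of_differentiableAt fun z hz => ?_
  have := moebius_denom_ne_zero a hz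
  unfold moebiusDeriv
  fun_prop (disch := assumption)

/-- The function `moebius theta a` applied to `lowerOp lam mu psi`. -/
noncomputable def lowerOpMoebius (lam mu : ℝ≥0) (psi : ℂ → ℂ) (theta : ℝ) (a : 𝔻) :
    WithLp 2 (DiscSpace lam × DiscSpace mu) →L[ℂ] WithLp 2 (DiscSpace lam × DiscSpace mu) :=
  blockOp (mulOp lam lam (moebius theta a)) 0
    (mulOp lam mu fun z => psi z * moebiusDeriv theta a z) (mulOp mu mu (moebius theta a))

section

variable {lam mu : ℝ≥0}

theorem moebius_mul_sub (theta : ℝ) (a : 𝔻) {z : ℂ} (hz : ‖z‖ ≤ 1) (w : ℂ) :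
    moebius theta a z * (w - conj (a : ℂ) * (z * w)) = exp (theta * I) * (z * w - a * w) := by
  have h1 := moebius_denom_ne_zero a hz
  have h2 : w - conj (a : ℂ) * (z * w) = (1 - conj (a : ℂ) * z) * w := by ring
  rw [moebius, h2, ← mul_assoc, mul_assoc (exp _), div_mul_cancel₀ _ h1]
  ring

theorem lowerOpMoebius_mul (hlam : 1 ≤ lam) (hmu : lam ≤ mu) {psi : ℂ → ℂ}
    (hpsi : DiffContOnCl ℂ psi (ball 0 1)) (theta : ℝ) (a : 𝔻) :
    lowerOpMoebius lam mu psi theta a * (1 - conj (a : ℂ) • lowerOp lam mu psi) =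
      exp (theta * I) • (lowerOp lam mu psi - (a : ℂ) • 1) := by
  have hm := diffContOnCl_moebius theta a
  have hd := hpsi.mul' (diffContOnCl_moebiusDeriv theta a)
  have h1 := hlam.trans hmu
  refine clm_prod_ext fun f g => ?_
  simp only [mul_apply_eq_comp, sub_apply, smul_apply, one_apply_eq_self, lowerOp, blockOp_apply]
  simp only [← WithLp.toLp_smul, ← WithLp.toLp_sub, Prod.smul_mk, Prod.mk_sub_mk, lowerOpMoebius,
    blockOp_apply, zero_apply, add_zero]
  congr 2
  · ext z
    simp only [mulOp_apply' hlam le_rfl hm, RKHS.coe_sub, RKHS.coe_smul, Pi.sub_apply,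
      Pi.smul_apply, mulZ_apply hlam, smul_eq_mul]
    exact moebius_mul_sub theta a z.norm_lt_one.le _
  · ext z
    simp only [mulOp_apply' h1 le_rfl hm, mulOp_apply' hlam hmu hd, mulOp_apply' hlam hmu hpsi,
      RKHS.coe_sub, RKHS.coe_add, RKHS.coe_smul, Pi.sub_apply, Pi.add_apply,
      Pi.smul_apply, mulZ_apply hlam, mulZ_apply h1, smul_eq_mul]
    have h2 := moebius_mul_sub theta a z.norm_lt_one.le (g z)
    have h3 : moebiusDeriv theta a z * (1 - conj (a : ℂ) * z) - conj (a : ℂ) * moebius theta a z =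
        exp (theta * I) := by
      have := moebius_denom_ne_zero a z.norm_lt_one.le
      rw [moebiusDeriv, moebius]
      field_simp
      ring
    linear_combination h2 + (psi z * f z) * h3

theorem moebiusCalculus_star_lowerOp (hlam : 1 ≤ lam) (hmu : lam ≤ mu) {psi : ℂ → ℂ}
    (hpsi : DiffContOnCl ℂ psi (ball 0 1)) (theta : ℝ) (a : 𝔻) :
    moebiusCalculus theta a (star (lowerOp lam mu psi)) =
      star (lowerOpMoebius lam mu psi (-theta) (star a)) := by
  have hA : ‖ContinuousLinearMap.adjoint (mulZ lam)‖ ≤ 1 := by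
    rw [LinearIsometryEquiv.norm_map]; exact norm_mulZ_le hlam
  have hD : ‖ContinuousLinearMap.adjoint (mulZ mu)‖ ≤ 1 := by
    rw [LinearIsometryEquiv.norm_map]; exact norm_mulZ_le (hlam.trans hmu)
  have hT : star (lowerOp lam mu psi) = blockOp (ContinuousLinearMap.adjoint (mulZ lam))
      (ContinuousLinearMap.adjoint (mulOp lam mu psi)) 0
      (ContinuousLinearMap.adjoint (mulZ mu)) := by
    rw [lowerOp, star_blockOp, map_zero]
  have h := star_mul_one_sub_smul (lowerOpMoebius_mul hlam hmu hpsi (-theta) (star a))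
  rw [moebiusCalculus_eq (by rw [hT]; exact spectrum_blockOp_subset hA hD _)]
  have hU : IsUnit (1 - conj (a : ℂ) • star (lowerOp lam mu psi)) := by
    rw [hT]
    exact isUnit_one_sub_smul_blockOp hA hD _ (by rw [RCLike.norm_conj]; exact a.norm_lt_one)
  have he : conj (exp ((-theta : ℝ) * I)) = exp (theta * I) := by
    rw [← exp_conj]
    simp
  rw [he, UnitDisc.coe_star, conj_conj, conj_conj] at h
  rw [Algebra.algebraMap_eq_smul_one, ← mul_smul_comm, ← h, ← mul_assoc,
    Ring.inverse_mul_cancel _ hU, one_mul]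

theorem weaklyHomogeneous_star_lowerOp_iff (hlam : 1 ≤ lam) (hmu : lam ≤ mu) {psi : ℂ → ℂ}
    (hpsi : DiffContOnCl ℂ psi (ball 0 1)) :
    WeaklyHomogeneous (star (lowerOp lam mu psi)) ↔ ∀ (theta : ℝ) (a : 𝔻),
      ∃ Y, IsUnit Y ∧ lowerOpMoebius lam mu psi theta a * Y = Y * lowerOp lam mu psi := by
  have hsp : spectrum ℂ (star (lowerOp lam mu psi)) ⊆ closedBall 0 1 := by
    rw [lowerOp, star_blockOp, map_zero]
    refine spectrum_blockOp_subset ?_ ?_ _ <;> rw [LinearIsometryEquiv.norm_map]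
    · exact norm_mulZ_le hlam
    · exact norm_mulZ_le (hlam.trans hmu)
  simp only [WeaklyHomogeneous, hsp, true_and, moebiusCalculus_star_lowerOp hlam hmu hpsi,
    isSimilar_star_iff]
  constructor
  · intro h theta a
    have := h (-theta) (star a)
    rwa [neg_neg, star_star] at this
  · exact fun h theta a => h (-theta) (star a)

theorem exists_compOp_isUnit (hlam : 1 ≤ lam) (theta : ℝ) (a : 𝔻) :
    ∃ A : DiscSpace lam →L[ℂ] DiscSpace lam, IsUnit A ∧
      ∀ f z, A f z = f (moebiusDisc theta a z) := by
  obtain ⟨A, hA⟩ := exists_compOp hlam theta a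
  obtain ⟨B, hB⟩ := exists_compOp hlam (-theta) (moebiusInvCenter theta a)
  have h1 : ∀ z, moebiusDisc theta a (moebiusDisc (-theta) (moebiusInvCenter theta a) z) = z :=
    fun z => UnitDisc.coe_injective (moebius_moebius_inv theta a z.norm_lt_one.le)
  have h2 : ∀ z, moebiusDisc (-theta) (moebiusInvCenter theta a) (moebiusDisc theta a z) = z :=
    fun z => UnitDisc.coe_injective (moebius_inv_moebius theta a z.norm_lt_one.le)
  refine ⟨A, ⟨⟨A, B, ?_, ?_⟩, rfl⟩, hA⟩ <;> ext f z
  · rw [mul_apply_eq_comp, hA, hB, h2, one_apply_eq_self]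
  · rw [mul_apply_eq_comp, hB, hA, h1, one_apply_eq_self]

/-- Composition with the inverse of a Moebius transformation `φ` turns `φ` of the operator
`lowerOp lam mu psi` into an operator of the form `lowerOp lam mu q`. -/
theorem exists_isUnit_mul_lowerOpMoebius (hlam : 1 ≤ lam) (hmu : lam ≤ mu) {psi : ℂ → ℂ}
    (hpsi : DiffContOnCl ℂ psi (ball 0 1)) (theta : ℝ) (a : 𝔻) {q : ℂ → ℂ}
    (hq : DiffContOnCl ℂ q (ball 0 1))
    (hqz : ∀ z : 𝔻, q (moebius theta a z) = psi z * moebiusDeriv theta a z) :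
    ∃ U, IsUnit U ∧ U * lowerOpMoebius lam mu psi theta a = lowerOp lam mu q * U := by
  have h1 := hlam.trans hmu
  obtain ⟨A, hAu, hA⟩ := exists_compOp_isUnit hlam (-theta) (moebiusInvCenter theta a)
  obtain ⟨D, hDu, hD⟩ := exists_compOp_isUnit h1 (-theta) (moebiusInvCenter theta a)
  refine ⟨_, isUnit_blockOp_diag hAu hDu, ?_⟩
  have hm := diffContOnCl_moebius theta a
  have hd := hpsi.mul' (diffContOnCl_moebiusDeriv theta a)
  have hz : ∀ z : 𝔻, moebius theta a (moebiusDisc (-theta) (moebiusInvCenter theta a) z) = z :=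
    fun z => moebius_moebius_inv theta a z.norm_lt_one.le
  refine clm_prod_ext fun f g => ?_
  simp only [mul_apply_eq_comp, lowerOp, lowerOpMoebius, blockOp_apply, zero_apply, add_zero,
    zero_add]
  congr 2
  · ext z
    rw [hA, mulZ_apply hlam, hA, mulOp_apply' hlam le_rfl hm, hz]
  · ext z
    rw [hD, RKHS.coe_add, RKHS.coe_add, Pi.add_apply, Pi.add_apply, mulZ_apply h1, hD,
      mulOp_apply' h1 le_rfl hm, hz, mulOp_apply' hlam hmu hd, mulOp_apply' hlam hmu hq, hA, ← hqz,
      hz]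

theorem exists_intertwiner_iff (hlam : 1 ≤ lam) (hmu : lam ≤ mu) {psi : ℂ → ℂ}
    (hpsi : DiffContOnCl ℂ psi (ball 0 1)) (theta : ℝ) (a : 𝔻) {q : ℂ → ℂ}
    (hq : DiffContOnCl ℂ q (ball 0 1))
    (hqz : ∀ z : 𝔻, q (moebius theta a z) = psi z * moebiusDeriv theta a z) :
    (∃ Y, IsUnit Y ∧ lowerOpMoebius lam mu psi theta a * Y = Y * lowerOp lam mu psi) ↔
      ∃ Y, IsUnit Y ∧ lowerOp lam mu q * Y = Y * lowerOp lam mu psi := by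
  obtain ⟨_, ⟨U, rfl⟩, hU⟩ := exists_isUnit_mul_lowerOpMoebius hlam hmu hpsi theta a hq hqz
  constructor
  · rintro ⟨Y, hY, h⟩
    exact ⟨U * Y, U.isUnit.mul hY, by rw [← mul_assoc, ← hU, mul_assoc, h, mul_assoc]⟩
  · rintro ⟨Y, hY, h⟩
    refine ⟨(↑U⁻¹ : _ →L[ℂ] _) * Y, U⁻¹.isUnit.mul hY, U.isUnit.mul_left_cancel ?_⟩
    rw [← mul_assoc, hU, mul_assoc, U.mul_inv_cancel_left, h, mul_assoc, U.mul_inv_cancel_left]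

theorem isUnit_mulOp (hlam : 1 ≤ lam) {m : ℂ → ℂ} (hm : DiffContOnCl ℂ m (ball 0 1))
    (h0 : ∀ z ∈ closedBall (0 : ℂ) 1, m z ≠ 0) : IsUnit (mulOp lam lam m) := by
  have hi : DiffContOnCl ℂ (fun z => (m z)⁻¹) (ball 0 1) :=
    hm.inv fun z hz => h0 z (by rwa [closure_unitBall] at hz)
  have h1 : ∀ z : 𝔻, m z ≠ 0 := fun z => h0 z (mem_closedBall_zero_iff.2 z.norm_lt_one.le)
  refine ⟨⟨mulOp lam lam m, mulOp lam lam fun z => (m z)⁻¹, ?_, ?_⟩, rfl⟩ <;> ext f z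
  · rw [mul_apply_eq_comp, mulOp_apply' hlam le_rfl hm, mulOp_apply' hlam le_rfl hi,
      mul_inv_cancel_left₀ (h1 z), one_apply_eq_self]
  · rw [mul_apply_eq_comp, mulOp_apply' hlam le_rfl hi, mulOp_apply' hlam le_rfl hm,
      inv_mul_cancel_left₀ (h1 z), one_apply_eq_self]

theorem exists_intertwiner_of_ne_zero (hlam : 1 ≤ lam) (hmu : lam ≤ mu) {psi q : ℂ → ℂ}
    (hpsi : DiffContOnCl ℂ psi (ball 0 1)) (hq : DiffContOnCl ℂ q (ball 0 1))
    (hpsi0 : ∀ z ∈ closedBall (0 : ℂ) 1, psi z ≠ 0) (hq0 : ∀ z ∈ closedBall (0 : ℂ) 1, q z ≠ 0) :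
    ∃ Y, IsUnit Y ∧ lowerOp lam mu q * Y = Y * lowerOp lam mu psi := by
  have h1 := hlam.trans hmu
  have hm : DiffContOnCl ℂ (fun z => q z * (psi z)⁻¹) (ball 0 1) :=
    hq.mul' (hpsi.inv fun z hz => hpsi0 z (by rwa [closure_unitBall] at hz))
  refine ⟨_, isUnit_blockOp_diag isUnit_one (isUnit_mulOp h1 hm fun z hz =>
    mul_ne_zero (hq0 z hz) (inv_ne_zero (hpsi0 z hz))), ?_⟩
  refine clm_prod_ext fun f g => ?_
  simp only [mul_apply_eq_comp, lowerOp, blockOp_apply, zero_apply, add_zero, zero_add,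
    one_apply_eq_self]
  congr 2
  ext z
  have h2 := hpsi0 z (mem_closedBall_zero_iff.2 z.norm_lt_one.le)
  simp only [RKHS.coe_add, Pi.add_apply, mulZ_apply h1, mulOp_apply' h1 le_rfl hm,
    mulOp_apply' hlam hmu hq, mulOp_apply' hlam hmu hpsi]
  field_simp

theorem exists_norm_symbol_ge {A : DiscSpace lam →L[ℂ] DiscSpace lam} {α : 𝔻 → ℂ}
    (hA : ∀ f z, A f z = α z * f z) (hs : Function.Surjective A) :
    ∃ C > 0, ∀ z, 1 ≤ C * ‖α z‖ := by
  obtain ⟨C, hC, h⟩ := A.exists_preimage_norm_le hs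
  refine ⟨C, hC, fun z => ?_⟩
  obtain ⟨x, hx, hxC⟩ := h (kern lam z)
  have hpos : 0 < ‖kern lam z‖ ^ 2 := by
    rw [norm_kern_sq]
    exact Real.rpow_pos_of_pos (sub_pos.2 z.sq_norm_lt_one) _
  have h1 : ‖kern lam z‖ ^ 2 = ‖α z‖ * ‖x z‖ := by
    rw [← norm_mul, ← hA, hx, ← inner_kern, inner_self_eq_norm_sq_to_K]
    simp
  have h2 : ‖x z‖ ≤ C * ‖kern lam z‖ ^ 2 := by
    refine (norm_apply_le_norm_kern x z).trans ?_
    nlinarith [norm_nonneg (kern lam z)]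
  refine le_of_mul_le_mul_right ?_ hpos
  calc 1 * ‖kern lam z‖ ^ 2 = ‖α z‖ * ‖x z‖ := by rw [one_mul, h1]
    _ ≤ ‖α z‖ * (C * ‖kern lam z‖ ^ 2) := by gcongr
    _ = _ := by ring

theorem norm_symbol_le {D : DiscSpace mu →L[ℂ] DiscSpace mu} {δ : 𝔻 → ℂ}
    (hD : ∀ f z, D f z = δ z * f z) (z : 𝔻) : ‖δ z‖ ≤ ‖D‖ := by
  have hpos : 0 < ‖kern mu z‖ ^ 2 := by
    rw [norm_kern_sq]
    exact Real.rpow_pos_of_pos (sub_pos.2 z.sq_norm_lt_one) _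
  have h1 : ‖kern mu z z‖ = ‖kern mu z‖ ^ 2 := by
    rw [← inner_kern, inner_self_eq_norm_sq_to_K]
    simp
  refine le_of_mul_le_mul_right ?_ hpos
  calc ‖δ z‖ * ‖kern mu z‖ ^ 2 = ‖D (kern mu z) z‖ := by rw [hD, norm_mul, h1]
    _ ≤ ‖kern mu z‖ * (‖D‖ * ‖kern mu z‖) :=
      (norm_apply_le_norm_kern _ _).trans (by gcongr; exact D.le_opNorm _)
    _ = _ := by ring

theorem eq_zero_of_mul_eq_zero (hlam : 1 ≤ lam) {q : ℂ → ℂ} (hq : DiffContOnCl ℂ q (ball 0 1))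
    (hq0 : ∃ z : 𝔻, q z ≠ 0) {b : DiscSpace lam} (h : ∀ z : 𝔻, q z * b z = 0) : b = 0 := by
  obtain ⟨F, hF, hFb⟩ := exists_differentiableOn hlam b
  obtain ⟨z, hz⟩ := hq0
  have := AnalyticOnNhd.eq_zero_or_eq_zero_of_mul_eq_zero
    (hq.1.analyticOnNhd isOpen_ball) (hF.analyticOnNhd isOpen_ball)
    (fun w hw => by
      have := h (UnitDisc.mk w (mem_ball_zero_iff.1 hw))
      rwa [← hFb] at this) (convex_ball (0 : ℂ) 1).isPreconnected
  rcases this with h1 | h1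
  · exact absurd (h1 z (mem_ball_zero_iff.2 z.norm_lt_one)) hz
  · ext w
    rw [← hFb, h1 w (mem_ball_zero_iff.2 w.norm_lt_one)]
    simp

theorem norm_le_of_intertwiner (hlam : 1 ≤ lam) (hmu : lam ≤ mu) (hmu2 : mu < lam + 2)
    {psi q : ℂ → ℂ} (hpsi : DiffContOnCl ℂ psi (ball 0 1)) (hq : DiffContOnCl ℂ q (ball 0 1))
    (hq0 : ∃ z : 𝔻, q z ≠ 0)
    {Y : WithLp 2 (DiscSpace lam × DiscSpace mu) →L[ℂ] WithLp 2 (DiscSpace lam × DiscSpace mu)}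
    (hY : IsUnit Y) (h : lowerOp lam mu q * Y = Y * lowerOp lam mu psi) :
    ∃ C : ℝ, ∀ z : 𝔻, ‖q z‖ ≤ C * ‖psi z‖ := by
  have hmu1 := hlam.trans hmu
  obtain ⟨A, B, C, D, rfl⟩ := exists_eq_blockOp Y
  rw [lowerOp, lowerOp, blockOp_mul, blockOp_mul] at h
  obtain ⟨h11, h12, h21, h22⟩ := blockOp_inj h
  simp only [ContinuousLinearMap.zero_comp, ContinuousLinearMap.comp_zero, add_zero, zero_add]
    at h11 h12 h22
  have hB := apply_eq_mul_of_commute hmu1 hlam fun f => (DFunLike.congr_fun h12 f).symm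
  have hB0 : B = 0 := by
    have h1 : mulOp lam mu q (B (oneFn mu)) = 0 := by
      refine eq_zero_of_commutator hmu1 hmu1 (lt_add_of_pos_right _ two_pos) D fun f z => ?_
      have h2 := congrArg (fun X : DiscSpace mu →L[ℂ] DiscSpace mu => X f z) h22
      simp only [add_apply, ContinuousLinearMap.comp_apply, RKHS.coe_add, Pi.add_apply,
        mulOp_apply' hlam hmu hq, mulZ_apply hmu1] at h2
      rw [← h2, mulOp_apply' hlam hmu hq, hB f z]
      ring
    have h3 : B (oneFn mu) = 0 := eq_zero_of_mul_eq_zero hlam hq hq0 fun z => by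
      rw [← mulOp_apply' hlam hmu hq, h1]
      simp
    ext f z
    rw [hB, h3]
    simp
  subst hB0
  simp only [ContinuousLinearMap.zero_comp, ContinuousLinearMap.comp_zero, add_zero, zero_add]
    at h11 h22
  have hA := apply_eq_mul_of_commute hlam hlam fun f => (DFunLike.congr_fun h11 f).symm
  have hD := apply_eq_mul_of_commute hmu1 hmu1 fun f => (DFunLike.congr_fun h22 f).symm
  have hAs := surjective_of_isUnit_blockOp_lower hY
  obtain ⟨c, hc, hcα⟩ := exists_norm_symbol_ge hA hAs
  have hδ := norm_symbol_le hD
  have hg : mulOp lam mu q (A (oneFn lam)) - D (mulOp lam mu psi (oneFn lam)) = 0 := by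
    refine eq_zero_of_commutator hlam hmu1 hmu2 C fun f z => ?_
    have h2 := congrArg (fun X : DiscSpace lam →L[ℂ] DiscSpace mu => X f z) h21
    simp only [add_apply, ContinuousLinearMap.comp_apply, RKHS.coe_add, Pi.add_apply,
      mulOp_apply' hlam hmu hq, mulZ_apply hmu1] at h2
    rw [hA, hD, mulOp_apply' hlam hmu hpsi] at h2
    rw [RKHS.coe_sub, Pi.sub_apply, mulOp_apply' hlam hmu hq, hD (mulOp lam mu psi _),
      mulOp_apply' hlam hmu hpsi, oneFn_apply]
    linear_combination -h2
  refine ⟨‖D‖ * c, fun z => ?_⟩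
  have hz : q z * A (oneFn lam) z = D (oneFn mu) z * psi z := by
    have := congrArg (fun f : DiscSpace mu => f z) hg
    simp only [RKHS.coe_sub, Pi.sub_apply, RKHS.coe_zero, Pi.zero_apply] at this
    rw [mulOp_apply' hlam hmu hq, hD (mulOp lam mu psi _),
      mulOp_apply' hlam hmu hpsi, oneFn_apply, mul_one] at this
    exact sub_eq_zero.1 this
  calc ‖q z‖ ≤ ‖q z‖ * (c * ‖A (oneFn lam) z‖) :=
        le_mul_of_one_le_right (norm_nonneg _) (hcα z)
    _ = ‖q z * A (oneFn lam) z‖ * c := by rw [norm_mul]; ring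
    _ ≤ ‖D‖ * ‖psi z‖ * c := by
      rw [hz, norm_mul]
      gcongr
      exact hδ z
    _ = _ := by ring

end

/-! ### Zeros and the main theorem -/

theorem exists_disc_ne_zero {psi : ℂ → ℂ} (hpsi : DiffContOnCl ℂ psi (ball 0 1))
    (hne : ∃ z ∈ closedBall (0 : ℂ) 1, psi z ≠ 0) : ∃ z : 𝔻, psi z ≠ 0 := by
  by_contra! h
  obtain ⟨z, hz, hz0⟩ := hne
  have h1 : Set.EqOn psi (fun _ => 0) (ball 0 1) := fun w hw =>
    h (UnitDisc.mk w (mem_ball_zero_iff.1 hw))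
  exact hz0 (h1.of_subset_closure hpsi.continuousOn_ball continuousOn_const ball_subset_closedBall
    closure_unitBall.ge hz)

theorem moebius_zero_of_eq (theta : ℝ) (z : ℂ) :
    moebius theta 0 z = exp (theta * I) * z := by
  simp [moebius]

/-- A function of the disc algebra whose zeros are invariant under Moebius transformations, and
which is not identically zero, has no zeros. -/
theorem ne_zero_of_moebius_invariant {psi : ℂ → ℂ} (hpsi : DiffContOnCl ℂ psi (ball 0 1))
    (hne : ∃ z ∈ closedBall (0 : ℂ) 1, psi z ≠ 0)
    (h : ∀ (theta : ℝ) (a : 𝔻), ∀ z ∈ closedBall (0 : ℂ) 1, psi z = 0 →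
      psi (moebius theta a z) = 0) : ∀ z ∈ closedBall (0 : ℂ) 1, psi z ≠ 0 := by
  intro z hz hz0
  obtain ⟨w, hw⟩ := exists_disc_ne_zero hpsi hne
  refine hw ?_
  have hz1 := mem_closedBall_zero_iff.1 hz
  rcases hz1.lt_or_eq with hlt | heq
  · have h1 := h 0 (UnitDisc.mk z hlt) z hz hz0
    have h2 : moebius 0 (UnitDisc.mk z hlt) z = 0 := by simp [moebius]
    rw [h2] at h1
    have h3 := h 0 (-w) 0 (by simp) h1
    have h4 : moebius 0 (-w) 0 = w := by simp [moebius]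
    rwa [h4] at h3
  · have h1 : Set.EqOn psi (fun _ => 0) (frontier (ball (0 : ℂ) 1)) := by
      intro u hu
      rw [frontier_ball _ one_ne_zero, mem_sphere_zero_iff_norm] at hu
      have h0 : z ≠ 0 := by rw [← norm_pos_iff, heq]; exact one_pos
      have h2 : ‖u / z‖ = 1 := by rw [norm_div, hu, heq, div_one]
      have h3 := h (u / z).arg 0 z hz hz0
      have h4 := norm_mul_exp_arg_mul_I (u / z)
      rw [h2, ofReal_one, one_mul] at h4
      rwa [moebius_zero_of_eq, h4, div_mul_cancel₀ _ h0] at h3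
    exact Complex.eqOn_closure_of_eqOn_frontier isBounded_ball hpsi diffContOnCl_const h1
      (subset_closure (mem_ball_zero_iff.2 w.norm_lt_one))

theorem weaklyHomogeneous_star_lowerOp_iff_ne_zero {lam mu : ℝ≥0} (hlam : 1 ≤ lam)
    (hmu : lam ≤ mu) (hmu2 : mu < lam + 2) {psi : ℂ → ℂ}
    (hpsi : DiffContOnCl ℂ psi (ball 0 1)) (hne : ∃ z ∈ closedBall (0 : ℂ) 1, psi z ≠ 0) :
    WeaklyHomogeneous (star (lowerOp lam mu psi)) ↔ ∀ z ∈ closedBall (0 : ℂ) 1, psi z ≠ 0 := by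
  rw [weaklyHomogeneous_star_lowerOp_iff hlam hmu hpsi]
  set q : ℝ → 𝔻 → ℂ → ℂ := fun theta a z =>
    psi (moebius (-theta) (moebiusInvCenter theta a) z) *
      moebiusDeriv theta a (moebius (-theta) (moebiusInvCenter theta a) z) with hqdef
  have hq : ∀ theta a, DiffContOnCl ℂ (q theta a) (ball 0 1) := fun theta a =>
    (hpsi.mul' (diffContOnCl_moebiusDeriv theta a)).comp_moebius _ _
  have hqz : ∀ theta a, ∀ z : 𝔻, q theta a (moebius theta a z) =
      psi z * moebiusDeriv theta a z := fun theta a z => by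
    simp only [hqdef, moebius_inv_moebius theta a z.norm_lt_one.le]
  have hiff := fun theta a => exists_intertwiner_iff hlam hmu hpsi theta a (hq theta a)
    (hqz theta a)
  simp only [hiff]
  constructor
  · intro h
    refine ne_zero_of_moebius_invariant hpsi hne fun theta a z hz hz0 => ?_
    obtain ⟨Y, hY, hYq⟩ := h (-theta) (moebiusInvCenter theta a)
    obtain ⟨w, hw⟩ := exists_disc_ne_zero hpsi hne
    obtain ⟨C, hC⟩ := norm_le_of_intertwiner hlam hmu hmu2 hpsi (hq _ _)
      ⟨moebiusDisc (-theta) (moebiusInvCenter theta a) w, by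
        rw [coe_moebiusDisc, hqz]
        exact mul_ne_zero hw (moebiusDeriv_ne_zero _ _ w.norm_lt_one.le)⟩ hY hYq
    have hz' : z ∈ closure (ball (0 : ℂ) 1) := by rwa [closure_unitBall]
    have h1 : ‖q (-theta) (moebiusInvCenter theta a) z‖ ≤ C * ‖psi z‖ :=
      ContinuousWithinAt.closure_le hz'
        (((hq _ _).2 z hz').norm.mono subset_closure)
        ((continuousWithinAt_const.mul (hpsi.2 z hz').norm).mono subset_closure)
        fun y hy => hC (UnitDisc.mk y (mem_ball_zero_iff.1 hy))
    rw [hz0, norm_zero, mul_zero, norm_le_zero_iff] at h1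
    simp only [hqdef, neg_neg, moebiusInvCenter_moebiusInvCenter] at h1
    exact (mul_eq_zero.1 h1).resolve_right
      (moebiusDeriv_ne_zero _ _ (norm_moebius_le_one _ _ (mem_closedBall_zero_iff.1 hz)))
  · intro h0 theta a
    refine exists_intertwiner_of_ne_zero hlam hmu hpsi (hq theta a) h0 fun z hz => ?_
    have := norm_moebius_le_one (-theta) (moebiusInvCenter theta a)
      (mem_closedBall_zero_iff.1 hz)
    exact mul_ne_zero (h0 _ (mem_closedBall_zero_iff.2 this)) (moebiusDeriv_ne_zero _ _ this)

theorem mainTheorem6 (lam mu : ℝ≥0) (hlam : 1 ≤ lam) (hmu : lam ≤ mu) (hmu2 : mu < lam + 2)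
    (psi : ℂ → ℂ) (hcont : ContinuousOn psi (Metric.closedBall 0 1))
    (hhol : DifferentiableOn ℂ psi (Metric.ball 0 1))
    (hne : ∃ z ∈ Metric.closedBall (0 : ℂ) 1, psi z ≠ 0) :
    IsMultiplier lam lam (fun z => z) ∧ IsMultiplier mu mu (fun z => z) ∧
      IsMultiplier lam mu psi ∧
      (WeaklyHomogeneous
          (blockOp (ContinuousLinearMap.adjoint (mulOp lam lam fun z => z))
            (ContinuousLinearMap.adjoint (mulOp lam mu psi))
            0 (ContinuousLinearMap.adjoint (mulOp mu mu fun z => z))) ↔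
        ∀ z ∈ Metric.closedBall (0 : ℂ) 1, psi z ≠ 0) := by
  have hpsi : DiffContOnCl ℂ psi (ball 0 1) := DiffContOnCl.mk_ball hhol hcont
  refine ⟨isMultiplier_of_diffContOnCl hlam le_rfl diffContOnCl_id',
    isMultiplier_of_diffContOnCl (hlam.trans hmu) le_rfl diffContOnCl_id',
    isMultiplier_of_diffContOnCl hlam hmu hpsi, ?_⟩
  have h := weaklyHomogeneous_star_lowerOp_iff_ne_zero hlam hmu hmu2 hpsi hne
  rwa [lowerOp, star_blockOp, map_zero] at h
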